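/- For $N \ge 1$ let $P_N$ be the joint eigenvalue law of the complex Ginibre ensemble with entries of variance $1/N$, that is, the probability measure on $\mathbb{C}^N$ $$dP_N(z_1,\dots,z_N) = \frac{1}{Z_N} \prod_{1 \le \ell < k \le N} |z_\ell - z_k|^2 \prod_{k=1}^N e^{-N|z_k|^2}\, d\Re(z_k)\, d\Im(z_k),$$ where $Z_N$ is the normalizing constant. For $F : \mathbb{C} \to \mathbb{R}$ write $X(F) = \sum_{k=1}^N F(z_k)$, and let $E$ and $\mathrm{Cov}_N$ denote expectation and covariance under $P_N$. Let $\delta > 0$ and $\varepsilon > 0$, and let $f(z) = f(|z|)$ and $g(z) = g(|z|)$ be bounded measurable real-valued radial functions on $\mathbb{C}$ which, as functions of $r = |z|$, belong to $C^{2,\delta}$ on $(0, 1+\varepsilon)$ with finite $C^{2,\delta}$ norm: they are twice continuously differentiable there, the functions and their first two derivatives are bounded there, and their second derivatives are uniformly $\delta$-Hölder continuous there. Then $f'(r) g'(r) r$ is integrable on $(0,1)$ and $$\lim_{N \to \infty} \mathrm{Cov}_N\bigl(X(f), X(g)\bigr) = \frac{1}{2} \int_0^1 f'(r)\, g'(r)\,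 r \, dr .$$ Moreover, as $N \to \infty$, the centered (but unnormalized) random variable $X(f) - E[X(f)]$ converges in distribution to a Gaussian random variable with mean zero and variance $\frac{1}{2} \int_0^1 f'(r)^2\, r \, dr$ (a point mass at $0$ if this variance vanishes). -/

import Mathlib

open MeasureTheory ProbabilityTheory Filter Set
open scoped NNReal ENNReal Topology

noncomputable section

/-- The (unnormalized) Gaussian weight `μ_N(dz) = exp (-N |z|²) d Re z d Im z` on `ℂ`. -/
def gaussianWeight (N : ℕ) : Measure ℂ :=
  (volume : Measure ℂ).withDensity fun z => ENNReal.ofReal (Real.exp (-(N : ℝ) * ‖z‖ ^ 2))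

/-- The squared modulus of the Vandermonde determinant, `∏_{l < k} |z_l - z_k|²`. -/
def vandermondeSq {N : ℕ} (z : Fin N → ℂ) : ℝ :=
  ∏ l : Fin N, ∏ k ∈ Finset.Ioi l, ‖z l - z k‖ ^ 2

/-- The measure `∏_{l < k} |z_l - z_k|² μ_N(dz_1) ⋯ μ_N(dz_N)` on `ℂ^N`. -/
def ginibreUnnormalized (N : ℕ) : Measure (Fin N → ℂ) :=
  (Measure.pi fun _ : Fin N => gaussianWeight N).withDensity
    fun z => ENNReal.ofReal (vandermondeSq z)

/-- The joint law `P_N` of the eigenvalues of the complex Ginibre ensemble, with entries of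
variance `1 / N`: the preceding measure divided by its total mass `Z_N`. -/
def ginibre (N : ℕ) : Measure (Fin N → ℂ) :=
  (ginibreUnnormalized N univ)⁻¹ • ginibreUnnormalized N

/-- The linear statistic `∑_k F (z_k)`. -/
def linearStatistic (N : ℕ) (F : ℂ → ℝ) (z : Fin N → ℂ) : ℝ :=
  ∑ k, F (z k)

/-- The radial function `z ↦ f |z|` on `ℂ` with profile `f`; only the values of `f` on `[0, ∞)`
matter. -/
def radial (f : ℝ → ℝ) (z : ℂ) : ℝ := f ‖z‖

/-- The Hölder class `C^{2,δ}(s)` for an open set `s` of reals, that is finiteness of the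
`C^{2,δ}` norm: `f` is `C²` on `s`, the derivatives of order at most two are bounded on `s`, and
the second derivative is (uniformly) `δ`-Hölder on `s`. -/
structure MemC2Holder (δ : ℝ≥0) (f : ℝ → ℝ) (s : Set ℝ) : Prop where
  contDiffOn : ContDiffOn ℝ 2 f s
  bounded : ∀ k ≤ 2, ∃ M : ℝ, ∀ x ∈ s, |iteratedDerivWithin k f s x| ≤ M
  holder : ∃ C : ℝ≥0, HolderOnWith C δ (iteratedDerivWithin 2 f s) s

/-- The test functions: measurable radial functions, bounded, and `C^{2,δ}` in the radial variable
`r ∈ (0, 1 + ε)`. -/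
structure IsRadialTest (δ : ℝ≥0) (ε : ℝ) (f : ℝ → ℝ) : Prop where
  measurable : Measurable (radial f)
  bounded : ∃ M : ℝ, ∀ r, 0 ≤ r → |f r| ≤ M
  memC2Holder : MemC2Holder δ f (Ioo 0 (1 + ε))

/-- The limiting covariance `(1/2) ∫₀¹ f'(r) g'(r) r dr`. -/
def limitCov (f g : ℝ → ℝ) : ℝ :=
  (1 / 2) * ∫ r in (0 : ℝ)..1, deriv f r * deriv g r * r

theorem limitCov_self_nonneg (f : ℝ → ℝ) : 0 ≤ limitCov f f := by
  unfold limitCov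
  refine mul_nonneg (by norm_num) (intervalIntegral.integral_nonneg zero_le_one ?_)
  intro r hr
  exact mul_nonneg (mul_self_nonneg _) hr.1

theorem one_add_norm_pow_le (m N : ℕ) (hN : 0 < N) (z : ℂ) :
    (1 + ‖z‖) ^ m * Real.exp (-(N : ℝ) * ‖z‖ ^ 2) ≤
      (m.factorial * Real.exp 2) * Real.exp (-(1 / 2 : ℝ) * ‖z‖ ^ 2) := by
  have hN' : (1 : ℝ) ≤ N := by exact_mod_cast hN
  have h0 : 0 ≤ ‖z‖ := norm_nonneg z
  have h1 : (1 + ‖z‖) ^ m ≤ m.factorial * Real.exp (1 + ‖z‖) := by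
    have := Real.pow_div_factorial_le_exp (1 + ‖z‖) (by positivity) m
    rwa [div_le_iff₀ (by positivity), mul_comm] at this
  calc (1 + ‖z‖) ^ m * Real.exp (-(N : ℝ) * ‖z‖ ^ 2)
      ≤ (m.factorial * Real.exp (1 + ‖z‖)) * Real.exp (-(N : ℝ) * ‖z‖ ^ 2) := by gcongr
    _ = m.factorial * Real.exp (1 + ‖z‖ + -(N : ℝ) * ‖z‖ ^ 2) := by
        rw [mul_assoc, ← Real.exp_add]
    _ ≤ m.factorial * Real.exp (2 + -(1 / 2 : ℝ) * ‖z‖ ^ 2) := by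
        refine mul_le_mul_of_nonneg_left (Real.exp_le_exp.2 ?_) (by positivity)
        nlinarith [sq_nonneg (‖z‖ - 1), mul_nonneg (sub_nonneg.2 hN') (sq_nonneg ‖z‖)]
    _ = _ := by rw [mul_assoc, ← Real.exp_add]

theorem integrable_one_add_norm_pow (m N : ℕ) (hN : 0 < N) :
    Integrable (fun z : ℂ => (1 + ‖z‖) ^ m * Real.exp (-(N : ℝ) * ‖z‖ ^ 2)) := by
  have hg : Integrable (fun z : ℂ => Real.exp (-(1 / 2 : ℝ) * ‖z‖ ^ 2)) := by
    have h := (GaussianFourier.integrable_cexp_neg_mul_sq_norm_add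
      (V := ℂ) (b := (1 / 2 : ℂ)) (by norm_num) 0 0).norm
    refine h.congr (ae_of_all _ fun z => ?_)
    simp only [Complex.norm_exp]
    congr 1
    have : (-(1 / 2 : ℂ) * (‖z‖ : ℂ) ^ 2 + 0 * (inner ℝ (0 : ℂ) z : ℝ)) =
        ((-(1 / 2 : ℝ) * ‖z‖ ^ 2 : ℝ) : ℂ) := by push_cast; ring
    rw [this, Complex.ofReal_re]
  refine (hg.const_mul (m.factorial * Real.exp 2)).mono' (by fun_prop) (ae_of_all _ fun z => ?_)
  rw [Real.norm_of_nonneg (by positivity)]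
  exact one_add_norm_pow_le m N hN z

theorem measurable_gaussianDensity (N : ℕ) :
    Measurable fun z : ℂ => ENNReal.ofReal (Real.exp (-(N : ℝ) * ‖z‖ ^ 2)) := by
  fun_prop

theorem integrable_gaussianWeight (m N : ℕ) (hN : 0 < N) :
    Integrable (fun z : ℂ => (1 + ‖z‖) ^ m) (gaussianWeight N) := by
  unfold gaussianWeight
  rw [integrable_withDensity_iff (measurable_gaussianDensity N) (ae_of_all _ fun _ => by simp)]
  refine (integrable_one_add_norm_pow m N hN).congr (ae_of_all _ fun z => ?_)
  simp only [ENNReal.toReal_ofReal (Real.exp_nonneg _)]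

instance instSigmaFiniteGaussianWeight (N : ℕ) : SigmaFinite (gaussianWeight N) :=
  SigmaFinite.withDensity_ofReal _

instance instIsOpenPosMeasureGaussianWeight (N : ℕ) :
    (gaussianWeight N).IsOpenPosMeasure := by
  refine Measure.AbsolutelyContinuous.isOpenPosMeasure
    (withDensity_absolutelyContinuous' (measurable_gaussianDensity N).aemeasurable ?_)
  exact ae_of_all _ fun z => by simp [Real.exp_pos]

theorem vandermondeSq_nonneg {N : ℕ} (z : Fin N → ℂ) : 0 ≤ vandermondeSq z :=
  Finset.prod_nonneg fun _ _ => Finset.prod_nonneg fun _ _ => by positivity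

theorem continuous_vandermondeSq (N : ℕ) :
    Continuous (vandermondeSq : (Fin N → ℂ) → ℝ) := by
  unfold vandermondeSq
  fun_prop

theorem vandermondeSq_le {N : ℕ} (z : Fin N → ℂ) :
    vandermondeSq z ≤ ∏ k : Fin N, (1 + ‖z k‖) ^ (2 * N * N) := by
  set P : ℝ := ∏ k : Fin N, (1 + ‖z k‖) with hP
  have hone : ∀ k : Fin N, (1 : ℝ) ≤ 1 + ‖z k‖ := fun k => by linarith [norm_nonneg (z k)]
  have hP1 : 1 ≤ P := by
    have h := Finset.prod_le_prod (s := (Finset.univ : Finset (Fin N))) (f := fun _ => (1 : ℝ))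
      (fun _ _ => zero_le_one) fun k _ => hone k
    rwa [Finset.prod_const_one] at h
  have hpair : ∀ l : Fin N, ∀ k ∈ Finset.Ioi l, ‖z l - z k‖ ^ 2 ≤ P ^ 2 := by
    intro l k hk
    have hlk : l ≠ k := (Finset.mem_Ioi.1 hk).ne
    have h2 : (1 + ‖z l‖) * (1 + ‖z k‖) ≤ P := by
      rw [hP, ← Finset.prod_pair (f := fun j => 1 + ‖z j‖) hlk]
      exact Finset.prod_le_prod_of_subset_of_one_le (Finset.subset_univ _)
        (fun j _ => by positivity) fun j _ _ => hone j
    refine pow_le_pow_left₀ (norm_nonneg _) (le_trans ?_ h2) 2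
    nlinarith [norm_sub_le (z l) (z k), norm_nonneg (z l), norm_nonneg (z k),
      mul_nonneg (norm_nonneg (z l)) (norm_nonneg (z k))]
  have hrow : ∀ l : Fin N, ∏ k ∈ Finset.Ioi l, ‖z l - z k‖ ^ 2 ≤ (P ^ 2) ^ N := by
    intro l
    calc ∏ k ∈ Finset.Ioi l, ‖z l - z k‖ ^ 2 ≤ ∏ k ∈ Finset.Ioi l, P ^ 2 :=
          Finset.prod_le_prod (fun _ _ => by positivity) (hpair l)
      _ = (P ^ 2) ^ (Finset.Ioi l).card := by rw [Finset.prod_const]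
      _ ≤ (P ^ 2) ^ N := by
          refine pow_le_pow_right₀ (one_le_pow₀ hP1) ?_
          simpa using Finset.card_le_univ (Finset.Ioi l)
  calc vandermondeSq z ≤ ∏ _l : Fin N, (P ^ 2) ^ N :=
        Finset.prod_le_prod (fun _ _ => Finset.prod_nonneg fun _ _ => by positivity)
          fun l _ => hrow l
    _ = P ^ (2 * N * N) := by simp [← pow_mul]
    _ = _ := by rw [hP, Finset.prod_pow]

theorem ginibreUnnormalized_ne_top (N : ℕ) : ginibreUnnormalized N univ ≠ ∞ := by
  unfold ginibreUnnormalized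
  rw [withDensity_apply _ MeasurableSet.univ, Measure.restrict_univ]
  have hint : Integrable (fun z : Fin N → ℂ => ∏ k, (1 + ‖z k‖) ^ (2 * N * N))
      (Measure.pi fun _ : Fin N => gaussianWeight N) := by
    refine Integrable.fintype_prod (f := fun _ w => (1 + ‖w‖) ^ (2 * N * N)) fun k => ?_
    exact integrable_gaussianWeight _ N (Fin.pos k)
  have hv : Integrable (vandermondeSq : (Fin N → ℂ) → ℝ)
      (Measure.pi fun _ : Fin N => gaussianWeight N) := by
    refine hint.mono' (continuous_vandermondeSq N).aestronglyMeasurable (ae_of_all _ fun z => ?_)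
    rw [Real.norm_of_nonneg (vandermondeSq_nonneg z)]
    exact vandermondeSq_le z
  exact hv.lintegral_lt_top.ne

theorem ginibreUnnormalized_ne_zero (N : ℕ) : ginibreUnnormalized N univ ≠ 0 := by
  unfold ginibreUnnormalized
  have hc : Continuous fun z : Fin N → ℂ => ENNReal.ofReal (vandermondeSq z) :=
    ENNReal.continuous_ofReal.comp (continuous_vandermondeSq N)
  rw [withDensity_apply _ MeasurableSet.univ, Measure.restrict_univ]
  refine ((lintegral_pos_iff_support hc.measurable).2 ?_).ne'
  refine (hc.isOpen_support).measure_pos _ ⟨fun k => ((k : ℕ) : ℂ), ?_⟩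
  rw [Function.mem_support]
  refine (ENNReal.ofReal_pos.2 ?_).ne'
  refine Finset.prod_pos fun l _ => Finset.prod_pos fun k hk => ?_
  have hlk : ((l : ℕ) : ℂ) - ((k : ℕ) : ℂ) ≠ 0 := by
    rw [sub_ne_zero]
    intro h
    exact (Finset.mem_Ioi.1 hk).ne (Fin.ext (by exact_mod_cast h))
  exact pow_pos (norm_pos_iff.2 hlk) 2

instance instIsProbabilityMeasureGinibre (N : ℕ) : IsProbabilityMeasure (ginibre N) :=
  ⟨by
    unfold ginibre
    rw [Measure.smul_apply, smul_eq_mul]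
    exact ENNReal.inv_mul_cancel (ginibreUnnormalized_ne_zero N) (ginibreUnnormalized_ne_top N)⟩

end

/-! For radial statistics the Ginibre ensemble reduces to independent variables. Expand the squared
Vandermonde determinant by the Leibniz formula as a double sum over permutations. Against a product
of radial functions, integration over the angles kills every off-diagonal term, so the expectation
factorizes (`integral_prod_ginibre`, Kostlan's theorem). Hence X(f) has the law of a sum of
independent variables f(R_j), where R_j² is Gamma distributed with shape j + 1 and rate N
(`map_linearStatistic_ginibre`).

The variable R_j² has mean a² = (j + 1)/N and variance (j + 1)/N². Linearizing f at a in the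
variable r² gives f(R_j) ≈ f(a) + f'(a)/(2a) · (R_j² - a²), whose variance is f'(a)²/(4N). The error
is O(1/(N√(j + 1))), and the fourth central moment of f(R_j) is O(1/N²)
(`IsTaylorProfile.radialLaw_estimates`). The errors are not uniformly o(1/N) near the origin, but
their sum over j vanishes by Cesàro averaging. The main terms form a Riemann sum for ∫₀¹ f'(√u)²/4
du, which is the claimed variance after u = r².

Covariances follow by polarization. The Gaussian limit is Lyapunov's theorem
(`tendsto_prod_integral_exp`): no normalization is needed, because N independent terms of variance
O(1/N) already have a bounded total variance. -/

/-! ### Characteristic functions and Lyapunov's theorem -/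

/-- For |x| ≤ 1 the exponential series has remainder at most e|x|³; for |x| ≥ 1 every term of the
trivial bound is absorbed by |x|³. -/
theorem norm_exp_mul_I_sub_taylor_two_le (x : ℝ) :
    ‖Complex.exp (x * Complex.I) - (1 + x * Complex.I - x ^ 2 / 2)‖ ≤ 4 * |x| ^ 3 := by
  rcases le_total |x| 1 with h | h
  · have h1 := Complex.norm_exp_sub_sum_le_norm_mul_exp (x * Complex.I) 3
    simp only [norm_mul, Complex.norm_I, mul_one, Complex.norm_real, Real.norm_eq_abs] at h1
    have h2 : (∑ m ∈ Finset.range 3, (x * Complex.I) ^ m / (m.factorial : ℂ)) =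
        1 + x * Complex.I - x ^ 2 / 2 := by
      simp only [Finset.sum_range_succ, Finset.sum_range_zero, Nat.factorial, mul_pow,
        Complex.I_sq]
      norm_num
      ring
    rw [h2] at h1
    refine h1.trans ?_
    rw [mul_comm]
    gcongr
    have := Real.exp_one_lt_d9
    have := Real.exp_le_exp.2 h
    linarith
  · have h1 : ‖Complex.exp (x * Complex.I)‖ = 1 := Complex.norm_exp_ofReal_mul_I x
    have h2 : ‖(1 + x * Complex.I - x ^ 2 / 2 : ℂ)‖ ≤ 1 + |x| + |x| ^ 2 / 2 := by
      refine (norm_sub_le _ _).trans ?_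
      gcongr
      · refine (norm_add_le _ _).trans ?_
        simp
      · simp
    refine (norm_sub_le _ _).trans ?_
    rw [h1]
    have h3 : |x| ≤ |x| ^ 3 := le_self_pow₀ h (by norm_num)
    have h4 : |x| ^ 2 ≤ |x| ^ 3 := pow_le_pow_right₀ h (by norm_num)
    linarith

theorem abs_exp_neg_sub_one_add_le {y : ℝ} (hy : 0 ≤ y) :
    |Real.exp (-y) - (1 - y)| ≤ y ^ 2 := by
  have h1 := Real.add_one_le_exp (-y)
  have h2 := Real.add_one_le_exp y
  have h3 : Real.exp (-y) ≤ 1 / (1 + y) := by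
    rw [Real.exp_neg, ← one_div]
    exact one_div_le_one_div_of_le (by linarith) (by linarith)
  have h4 : 1 / (1 + y) ≤ 1 - y + y ^ 2 := by
    rw [div_le_iff₀ (by linarith)]
    nlinarith [pow_nonneg hy 3]
  rw [abs_of_nonneg (by linarith)]
  linarith

/-- Telescoping: replace one factor at a time, all other factors having modulus at most 1. -/
theorem norm_prod_sub_prod_le {ι : Type*} (s : Finset ι) (a b : ι → ℂ)
    (ha : ∀ i ∈ s, ‖a i‖ ≤ 1) (hb : ∀ i ∈ s, ‖b i‖ ≤ 1) :
    ‖∏ i ∈ s, a i - ∏ i ∈ s, b i‖ ≤ ∑ i ∈ s, ‖a i - b i‖ := by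
  classical
  induction s using Finset.induction_on with
  | empty => simp
  | insert i s hi ih =>
    rw [Finset.prod_insert hi, Finset.prod_insert hi, Finset.sum_insert hi]
    have ih' := ih (fun j hj => ha j (Finset.mem_insert_of_mem hj))
      (fun j hj => hb j (Finset.mem_insert_of_mem hj))
    have hp : ‖∏ j ∈ s, a j‖ ≤ 1 := by
      rw [norm_prod]
      exact Finset.prod_le_one (fun _ _ => norm_nonneg _)
        fun j hj => ha j (Finset.mem_insert_of_mem hj)
    have hbi := hb i (Finset.mem_insert_self i s)
    calc ‖a i * ∏ j ∈ s, a j - b i * ∏ j ∈ s, b j‖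
        = ‖(a i - b i) * ∏ j ∈ s, a j + b i * (∏ j ∈ s, a j - ∏ j ∈ s, b j)‖ := by ring_nf
      _ ≤ ‖a i - b i‖ * ‖∏ j ∈ s, a j‖ + ‖b i‖ * ‖∏ j ∈ s, a j - ∏ j ∈ s, b j‖ := by
        refine (norm_add_le _ _).trans ?_
        rw [norm_mul, norm_mul]
      _ ≤ ‖a i - b i‖ * 1 + 1 * ∑ j ∈ s, ‖a j - b j‖ := by gcongr
      _ = _ := by ring

/-- Both exponentials are compared with 1 - t²v/2, where v is the variance. The parameter η trades
the third absolute moment for the second and fourth, since the even moments are the ones available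
later. -/
theorem norm_integral_exp_sub_exp_le {Ω : Type*} [MeasurableSpace Ω] (μ : Measure Ω)
    [IsProbabilityMeasure μ] {W : Ω → ℝ} (hW : Measurable W) {M : ℝ} (hM : ∀ ω, |W ω| ≤ M)
    (h0 : ∫ ω, W ω ∂μ = 0) {η : ℝ} (hη : 0 < η) (t : ℝ) :
    ‖∫ ω, Complex.exp ((t * W ω : ℝ) * Complex.I) ∂μ -
        Complex.exp (-(t ^ 2 * (∫ ω, W ω ^ 2 ∂μ) / 2 : ℝ))‖ ≤
      2 * |t| ^ 3 * (η * (∫ ω, W ω ^ 2 ∂μ) + (∫ ω, W ω ^ 4 ∂μ) / η) +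
        t ^ 4 * (∫ ω, W ω ^ 2 ∂μ) ^ 2 / 4 := by
  have hint : ∀ k : ℕ, Integrable (fun ω => W ω ^ k) μ := fun k =>
    Integrable.of_bound (hW.pow_const k).aestronglyMeasurable (M ^ k) (ae_of_all _ fun ω => by
      rw [norm_pow]
      exact pow_le_pow_left₀ (norm_nonneg _) (hM ω) k)
  have hint1 : Integrable W μ := by simpa using hint 1
  set v : ℝ := ∫ ω, W ω ^ 2 ∂μ with hv
  have hv0 : 0 ≤ v := integral_nonneg fun ω => sq_nonneg _
  have hE : Integrable (fun ω => Complex.exp ((t * W ω : ℝ) * Complex.I)) μ := by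
    refine Integrable.of_bound (by fun_prop) 1 (ae_of_all _ fun ω => ?_)
    rw [Complex.norm_exp_ofReal_mul_I]
  have hT : Integrable (fun ω => (1 + (t * W ω : ℝ) * Complex.I -
      ((t * W ω : ℝ) : ℂ) ^ 2 / 2 : ℂ)) μ := by
    have h1 : Integrable (fun ω => ((t * W ω : ℝ) : ℂ)) μ := (hint1.const_mul t).ofReal
    have h2 : Integrable (fun ω => (((t ^ 2 * W ω ^ 2 : ℝ)) : ℂ)) μ :=
      ((hint 2).const_mul (t ^ 2)).ofReal
    refine ((integrable_const (1 : ℂ)).add (h1.mul_const Complex.I)).sub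
      ((h2.div_const 2).congr (ae_of_all _ fun ω => ?_))
    push_cast
    ring
  have hTi : ∫ ω, (1 + (t * W ω : ℝ) * Complex.I - ((t * W ω : ℝ) : ℂ) ^ 2 / 2 : ℂ) ∂μ =
      ((1 - t ^ 2 * v / 2 : ℝ) : ℂ) := by
    have h1 : Integrable (fun ω => ((t * W ω : ℝ) : ℂ)) μ := (hint1.const_mul t).ofReal
    have h2 : Integrable (fun ω => (((t ^ 2 * W ω ^ 2 : ℝ)) : ℂ)) μ :=
      ((hint 2).const_mul (t ^ 2)).ofReal
    have e : (fun ω => (1 + (t * W ω : ℝ) * Complex.I - ((t * W ω : ℝ) : ℂ) ^ 2 / 2 : ℂ)) =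
        fun ω => (1 + (t * W ω : ℝ) * Complex.I) - ((t ^ 2 * W ω ^ 2 : ℝ) : ℂ) / 2 := by
      funext ω; push_cast; ring
    have h3 : Integrable (fun ω => (1 + (t * W ω : ℝ) * Complex.I : ℂ)) μ :=
      (integrable_const (1 : ℂ)).add (h1.mul_const Complex.I)
    rw [e, integral_sub h3 (h2.div_const 2), integral_add (integrable_const (1 : ℂ)) (h1.mul_const Complex.I),
      integral_mul_const, integral_div, integral_complex_ofReal, integral_complex_ofReal,
      integral_const_mul, integral_const_mul, h0]
    simp [hv]
  have hA : ‖∫ ω, Complex.exp ((t * W ω : ℝ) * Complex.I) ∂μ - ((1 - t ^ 2 * v / 2 : ℝ) : ℂ)‖ ≤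
      2 * |t| ^ 3 * (η * v + (∫ ω, W ω ^ 4 ∂μ) / η) := by
    rw [← hTi, ← integral_sub hE hT]
    have hb : Integrable (fun ω => 2 * |t| ^ 3 * (η * W ω ^ 2 + W ω ^ 4 / η)) μ :=
      (((hint 2).const_mul η).add ((hint 4).div_const η)).const_mul _
    refine (norm_integral_le_of_norm_le hb (ae_of_all _ fun ω => ?_)).trans_eq ?_
    · refine (norm_exp_mul_I_sub_taylor_two_le _).trans ?_
      rw [abs_mul, mul_pow]
      -- Young's inequality: the difference of the two sides is W²(η - |W|)²/η.
      have h3 : 2 * |W ω| ^ 3 ≤ η * W ω ^ 2 + W ω ^ 4 / η := by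
        have e2 : W ω ^ 2 = |W ω| ^ 2 := (sq_abs _).symm
        have e4 : W ω ^ 4 = |W ω| ^ 4 := by rw [← abs_pow, abs_of_nonneg (by positivity)]
        rw [e2, e4, ← sub_nonneg]
        have : η * |W ω| ^ 2 + |W ω| ^ 4 / η - 2 * |W ω| ^ 3 =
            |W ω| ^ 2 * (η - |W ω|) ^ 2 / η := by
          field_simp
          ring
        rw [this]
        positivity
      nlinarith [pow_nonneg (abs_nonneg t) 3]
    · rw [integral_const_mul, integral_add ((hint 2).const_mul η) ((hint 4).div_const η),
        integral_const_mul, integral_div]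
  have hB : ‖((1 - t ^ 2 * v / 2 : ℝ) : ℂ) - Complex.exp (-(t ^ 2 * v / 2 : ℝ))‖ ≤
      t ^ 4 * v ^ 2 / 4 := by
    have h := abs_exp_neg_sub_one_add_le (y := t ^ 2 * v / 2) (by positivity)
    rw [← Complex.ofReal_neg, ← Complex.ofReal_exp, ← Complex.ofReal_sub, Complex.norm_real,
      Real.norm_eq_abs, abs_sub_comm]
    refine h.trans_eq ?_
    ring
  calc _ ≤ _ := norm_sub_le_norm_sub_add_norm_sub _ ((1 - t ^ 2 * v / 2 : ℝ) : ℂ) _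
    _ ≤ _ := add_le_add hA hB

/-- A Lyapunov central limit theorem for triangular arrays, for characteristic functions. -/
theorem tendsto_prod_integral_exp {Ω : Type*} [MeasurableSpace Ω]
    (ν : (N : ℕ) → Fin N → Measure Ω) [∀ N i, IsProbabilityMeasure (ν N i)]
    (W : (N : ℕ) → Fin N → Ω → ℝ) (hW : ∀ N i, Measurable (W N i)) {M : ℝ}
    (hM : ∀ N i ω, |W N i ω| ≤ M) (h0 : ∀ N i, ∫ ω, W N i ω ∂(ν N i) = 0) {K : ℝ}
    (h2 : ∀ N i, ∫ ω, W N i ω ^ 2 ∂(ν N i) ≤ K / N)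
    (h4 : ∀ N i, ∫ ω, W N i ω ^ 4 ∂(ν N i) ≤ K / (N : ℝ) ^ 2) {σ2 : ℝ}
    (hσ : Tendsto (fun N => ∑ i, ∫ ω, W N i ω ^ 2 ∂(ν N i)) atTop (𝓝 σ2)) (t : ℝ) :
    Tendsto (fun N => ∏ i, ∫ ω, Complex.exp ((t * W N i ω : ℝ) * Complex.I) ∂(ν N i)) atTop
      (𝓝 (Complex.exp (-(t ^ 2 * σ2 / 2 : ℝ)))) := by
  have hlim : Tendsto (fun N => ∏ i,
      Complex.exp (-(t ^ 2 * (∫ ω, W N i ω ^ 2 ∂(ν N i)) / 2 : ℝ))) atTop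
      (𝓝 (Complex.exp (-(t ^ 2 * σ2 / 2 : ℝ)))) := by
    have h : Tendsto (fun N => Complex.exp
        (-(t ^ 2 * (∑ i, ∫ ω, W N i ω ^ 2 ∂(ν N i)) / 2 : ℝ))) atTop
        (𝓝 (Complex.exp (-(t ^ 2 * σ2 / 2 : ℝ)))) := by
      have hc : Continuous fun s : ℝ => Complex.exp (-(t ^ 2 * s / 2 : ℝ)) := by fun_prop
      exact (hc.tendsto σ2).comp hσ
    refine h.congr fun N => ?_
    rw [← Complex.exp_sum]
    congr 1
    push_cast
    rw [Finset.mul_sum, Finset.sum_div, Finset.sum_neg_distrib]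
  refine (tendsto_iff_of_dist ?_).2 hlim
  have hz : Tendsto (fun N : ℕ => 4 * |t| ^ 3 * K * (1 / √(N : ℝ)) + t ^ 4 * K ^ 2 / 4 * (1 / (N : ℝ)))
      atTop (𝓝 0) := by
    have h1 : Tendsto (fun N : ℕ => 1 / (N : ℝ)) atTop (𝓝 0) := tendsto_one_div_atTop_nhds_zero_nat
    have h3 : Tendsto (fun N : ℕ => 1 / √(N : ℝ)) atTop (𝓝 0) := by
      simp only [one_div]
      exact (Real.tendsto_sqrt_atTop.comp
        (tendsto_natCast_atTop_atTop (R := ℝ))).inv_tendsto_atTop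
    simpa using (h3.const_mul (4 * |t| ^ 3 * K)).add (h1.const_mul (t ^ 4 * K ^ 2 / 4))
  refine squeeze_zero' (Eventually.of_forall fun _ => dist_nonneg) ?_ hz
  filter_upwards [eventually_gt_atTop 0] with N hN
  have hN' : (0 : ℝ) < N := by exact_mod_cast hN
  have hs : 0 < √(N : ℝ) := Real.sqrt_pos.2 hN'
  have hss : √(N : ℝ) ^ 2 = N := Real.sq_sqrt hN'.le
  rw [dist_eq_norm]
  have hn : ∀ i, ‖∫ ω, Complex.exp ((t * W N i ω : ℝ) * Complex.I) ∂(ν N i)‖ ≤ 1 := fun i => by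
    refine (norm_integral_le_of_norm_le_const (C := 1) (ae_of_all _ fun ω => ?_)).trans ?_
    · rw [Complex.norm_exp_ofReal_mul_I]
    · simp
  have hn' : ∀ i, ‖Complex.exp (-(t ^ 2 * (∫ ω, W N i ω ^ 2 ∂(ν N i)) / 2 : ℝ))‖ ≤ 1 := fun i => by
    rw [← Complex.ofReal_neg, Complex.norm_exp_ofReal, Real.exp_le_one_iff, neg_nonpos]
    have : 0 ≤ ∫ ω, W N i ω ^ 2 ∂(ν N i) := integral_nonneg fun ω => sq_nonneg _
    positivity
  refine (norm_prod_sub_prod_le _ _ _ (fun i _ => hn i) (fun i _ => hn' i)).trans ?_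
  have hterm : ∀ i : Fin N, ‖∫ ω, Complex.exp ((t * W N i ω : ℝ) * Complex.I) ∂(ν N i) -
      Complex.exp (-(t ^ 2 * (∫ ω, W N i ω ^ 2 ∂(ν N i)) / 2 : ℝ))‖ ≤
      (4 * |t| ^ 3 * K * (1 / √(N : ℝ)) + t ^ 4 * K ^ 2 / 4 * (1 / (N : ℝ))) / N := fun i => by
    have hv0 : 0 ≤ ∫ ω, W N i ω ^ 2 ∂(ν N i) := integral_nonneg fun ω => sq_nonneg _
    -- The choice η = 1/√N balances ηK/N with K/(N²η): both equal K/N^(3/2), so N factors contribute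
    -- O(1/√N).
    have hη : 0 < 1 / √(N : ℝ) := by positivity
    refine (norm_integral_exp_sub_exp_le (ν N i) (hW N i) (hM N i) (h0 N i) hη t).trans ?_
    calc _ ≤ 2 * |t| ^ 3 * (1 / √(N : ℝ) * (K / N) + K / (N : ℝ) ^ 2 / (1 / √(N : ℝ))) +
          t ^ 4 * (K / N) ^ 2 / 4 := by
            have e4 : 0 ≤ t ^ 4 := by positivity
            gcongr
            · exact h2 N i
            · exact h4 N i
            · exact h2 N i
      _ = _ := by
        have e : K / (N : ℝ) ^ 2 / (1 / √(N : ℝ)) = 1 / √(N : ℝ) * (K / N) := by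
          field_simp
          rw [hss]
        rw [e]
        field_simp
        ring
  refine (Finset.sum_le_sum fun i _ => hterm i).trans_eq ?_
  simp only [Finset.sum_const, Finset.card_univ, Fintype.card_fin, nsmul_eq_mul]
  field_simp

/-! ### Gaussian moments and the laws of the moduli -/

theorem integral_gaussianWeight {E : Type*} [NormedAddCommGroup E] [NormedSpace ℝ E] (N : ℕ)
    (F : ℂ → E) :
    ∫ z, F z ∂(gaussianWeight N) = ∫ z, Real.exp (-(N : ℝ) * ‖z‖ ^ 2) • F z := by
  unfold gaussianWeight
  rw [integral_withDensity_eq_integral_toReal_smul (measurable_gaussianDensity N)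
    (ae_of_all _ fun _ => by simp)]
  simp only [ENNReal.toReal_ofReal (Real.exp_nonneg _)]

theorem integrable_norm_pow_gaussianWeight {N : ℕ} (hN : 0 < N) (m : ℕ) :
    Integrable (fun z : ℂ => ‖z‖ ^ m) (gaussianWeight N) := by
  refine (integrable_gaussianWeight m N hN).mono' (by fun_prop) (ae_of_all _ fun z => ?_)
  rw [Real.norm_of_nonneg (by positivity)]
  exact pow_le_pow_left₀ (norm_nonneg _) (by linarith) m

theorem integral_norm_pow_gaussianWeight {N : ℕ} (hN : 0 < N) (m : ℕ) :
    ∫ z, ‖z‖ ^ (2 * m) ∂(gaussianWeight N) = Real.pi * m.factorial / (N : ℝ) ^ (m + 1) := by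
  have hN' : (0 : ℝ) < N := by exact_mod_cast hN
  have h := Complex.integral_rpow_mul_exp_neg_mul_rpow (p := 2) (q := (2 * m : ℕ)) (b := N)
    (by norm_num) (by have : (0 : ℝ) ≤ (2 * m : ℕ) := Nat.cast_nonneg _
                      linarith) hN'
  simp only [Real.rpow_natCast, Real.rpow_two] at h
  rw [integral_gaussianWeight]
  simp only [smul_eq_mul]
  simp only [mul_comm (Real.exp _)]
  rw [h]
  have e1 : -(((2 * m : ℕ) : ℝ) + 2) / 2 = -((m + 1 : ℕ) : ℝ) := by push_cast; ring
  have e2 : (((2 * m : ℕ) : ℝ) + 2) / 2 = (m : ℝ) + 1 := by push_cast; ring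
  rw [e1, e2, Real.rpow_neg hN'.le, Real.rpow_natCast, Real.Gamma_nat_eq_factorial]
  field_simp

/-- The measure on `ℂ` with density proportional to `|z|^{2 j} exp (-N |z|²)`. -/
noncomputable def radialLaw (N : ℕ) (j : Fin N) : Measure ℂ :=
  (gaussianWeight N).withDensity fun z =>
    ENNReal.ofReal (‖z‖ ^ (2 * (j : ℕ)) / (Real.pi * (j : ℕ).factorial / (N : ℝ) ^ ((j : ℕ) + 1)))

theorem integral_radialLaw {E : Type*} [NormedAddCommGroup E] [NormedSpace ℝ E] (N : ℕ)
    (j : Fin N) (F : ℂ → E) :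
    ∫ z, F z ∂(radialLaw N j) =
      (Real.pi * (j : ℕ).factorial / (N : ℝ) ^ ((j : ℕ) + 1))⁻¹ •
        ∫ z, ‖z‖ ^ (2 * (j : ℕ)) • F z ∂(gaussianWeight N) := by
  unfold radialLaw
  rw [integral_withDensity_eq_integral_toReal_smul (by fun_prop)
    (ae_of_all _ fun _ => by simp), ← integral_smul]
  refine integral_congr_ae (ae_of_all _ fun z => ?_)
  simp only
  rw [ENNReal.toReal_ofReal (by positivity), smul_smul, div_eq_inv_mul]

/-- These are the moments of a Gamma variable of shape j + 1 and rate N, which is the law of |z|².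
The case m = 0 shows that the density is normalized. -/
theorem integral_norm_pow_radialLaw (N : ℕ) (j : Fin N) (m : ℕ) :
    ∫ z, ‖z‖ ^ (2 * m) ∂(radialLaw N j) =
      ((j : ℕ) + m).factorial / ((j : ℕ).factorial * (N : ℝ) ^ m) := by
  have hN' : (0 : ℝ) < N := by exact_mod_cast Fin.pos j
  rw [integral_radialLaw]
  simp only [smul_eq_mul, ← pow_add, ← mul_add]
  rw [integral_norm_pow_gaussianWeight (Fin.pos j)]
  have := Real.pi_pos
  field_simp
  ring

theorem integrable_norm_pow_radialLaw (N : ℕ) (j : Fin N) (m : ℕ) :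
    Integrable (fun z : ℂ => ‖z‖ ^ m) (radialLaw N j) := by
  unfold radialLaw
  rw [integrable_withDensity_iff (by fun_prop) (ae_of_all _ fun _ => by simp)]
  refine ((integrable_norm_pow_gaussianWeight (Fin.pos j) (m + 2 * (j : ℕ))).div_const
    (Real.pi * (j : ℕ).factorial / (N : ℝ) ^ ((j : ℕ) + 1))).congr (ae_of_all _ fun z => ?_)
  simp only
  rw [ENNReal.toReal_ofReal (by positivity), pow_add]
  ring

instance instIsProbabilityMeasureRadialLaw (N : ℕ) (j : Fin N) :
    IsProbabilityMeasure (radialLaw N j) := by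
  have hi := integrable_norm_pow_radialLaw N j 0
  have h := integral_norm_pow_radialLaw N j 0
  simp only [pow_zero, mul_zero, integral_const, smul_eq_mul, mul_one, add_zero] at h hi
  rw [div_self (by positivity)] at h
  have hf : IsFiniteMeasure (radialLaw N j) := by
    rw [integrable_const_iff] at hi
    simpa using hi
  constructor
  rw [measureReal_def] at h
  rw [← ENNReal.ofReal_toReal (measure_ne_top (radialLaw N j) univ), h, ENNReal.ofReal_one]

/-! ### Angular orthogonality and Kostlan's theorem -/

/-- Rotation by the angle π/(a - b) preserves Lebesgue measure and multiplies the integrand by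
exp(iπ) = -1, so the integral equals its own negative. No integrability is needed. -/
theorem integral_radial_mul_pow_mul_conj_pow_eq_zero (N : ℕ) (h : ℝ → ℂ) {a b : ℕ} (hab : a ≠ b) :
    ∫ z, h ‖z‖ * (z ^ a * (starRingEnd ℂ z) ^ b) ∂(gaussianWeight N) = 0 := by
  rw [integral_gaussianWeight]
  set F : ℂ → ℂ := fun z => Real.exp (-(N : ℝ) * ‖z‖ ^ 2) •
    (h ‖z‖ * (z ^ a * (starRingEnd ℂ z) ^ b)) with hF
  change ∫ z, F z = 0
  have hab' : ((a : ℝ) - b) ≠ 0 := sub_ne_zero.2 (by exact_mod_cast hab)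
  set c : Circle := Circle.exp (Real.pi / ((a : ℝ) - b)) with hc
  have hcc : (c : ℂ) ^ a * (starRingEnd ℂ (c : ℂ)) ^ b = -1 := by
    rw [hc, Circle.coe_exp, ← Complex.exp_conj, ← Complex.exp_nat_mul, ← Complex.exp_nat_mul,
      ← Complex.exp_add, map_mul, Complex.conj_I, Complex.conj_ofReal, ← Complex.exp_pi_mul_I]
    congr 1
    have : ((a : ℂ) - b) ≠ 0 := by exact_mod_cast hab'
    push_cast
    field_simp
    ring
  have hrot : ∀ z, F (rotation c z) = -F z := fun z => by
    have hn : ‖(c : ℂ) * z‖ = ‖z‖ := by rw [norm_mul, Circle.norm_coe, one_mul]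
    simp only [hF, rotation_apply, map_mul, mul_pow, hn]
    rw [← smul_neg]
    congr 1
    linear_combination (h (‖z‖ : ℝ) * (z ^ a * (starRingEnd ℂ z) ^ b)) * hcc
  have hinv : ∫ z, F (rotation c z) = ∫ z, F z :=
    (rotation c).measurePreserving.integral_comp
      (rotation c).toHomeomorph.measurableEmbedding F
  simp only [hrot, integral_neg] at hinv
  exact self_eq_neg.1 hinv.symm

/-- The left side is the Vandermonde determinant times its conjugate; each is expanded by the
Leibniz formula. Every term is then a product of functions of single coordinates, ready for Fubini.
-/
theorem ofReal_vandermondeSq {N : ℕ} (z : Fin N → ℂ) :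
    ((vandermondeSq z : ℝ) : ℂ) = ∑ σ : Equiv.Perm (Fin N), ∑ τ : Equiv.Perm (Fin N),
      ((Equiv.Perm.sign σ : ℤ) : ℂ) * ((Equiv.Perm.sign τ : ℤ) : ℂ) *
        ∏ k, (z k ^ (σ k : ℕ) * (starRingEnd ℂ (z k)) ^ (τ k : ℕ)) := by
  have hdet : (Matrix.vandermonde z).det =
      ∑ σ : Equiv.Perm (Fin N), ((Equiv.Perm.sign σ : ℤ) : ℂ) * ∏ k, z k ^ (σ k : ℕ) := by
    rw [← Matrix.det_transpose, Matrix.det_apply']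
    simp [Matrix.vandermonde_apply]
  have hsq : ((vandermondeSq z : ℝ) : ℂ) =
      (Matrix.vandermonde z).det * starRingEnd ℂ (Matrix.vandermonde z).det := by
    rw [Complex.mul_conj, Matrix.det_vandermonde, Complex.normSq_eq_norm_sq, norm_prod,
      ← Finset.prod_pow]
    unfold vandermondeSq
    congr 1
    refine Finset.prod_congr rfl fun l _ => ?_
    rw [norm_prod, ← Finset.prod_pow]
    refine Finset.prod_congr rfl fun k _ => ?_
    rw [norm_sub_rev]
  rw [hsq, hdet, map_sum, Finset.sum_mul_sum]
  refine Finset.sum_congr rfl fun σ _ => Finset.sum_congr rfl fun τ _ => ?_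
  rw [map_mul, map_prod, Finset.prod_mul_distrib]
  simp only [map_pow, map_intCast]
  ring

theorem integral_prod_ginibreUnnormalized {N : ℕ} {h : ℝ → ℂ}
    (hm : Measurable fun z : ℂ => h ‖z‖) {M : ℝ} (hM : ∀ r, ‖h r‖ ≤ M) :
    ∫ z, ∏ k, h ‖z k‖ ∂(ginibreUnnormalized N) =
      N.factorial * ∏ i : Fin N, ∫ z, ‖z‖ ^ (2 * (i : ℕ)) • h ‖z‖ ∂(gaussianWeight N) := by
  unfold ginibreUnnormalized
  rw [integral_withDensity_eq_integral_toReal_smul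
    (f := fun z => ENNReal.ofReal (vandermondeSq z))
    (ENNReal.continuous_ofReal.comp (continuous_vandermondeSq N)).measurable
    (ae_of_all _ fun _ => by simp)]
  have hexp : ∀ z : Fin N → ℂ,
      (ENNReal.ofReal (vandermondeSq z)).toReal • ∏ k, h ‖z k‖ =
      ∑ σ : Equiv.Perm (Fin N), ∑ τ : Equiv.Perm (Fin N),
        ((Equiv.Perm.sign σ : ℤ) : ℂ) * ((Equiv.Perm.sign τ : ℤ) : ℂ) *
        ∏ k, (h ‖z k‖ * (z k ^ (σ k : ℕ) * (starRingEnd ℂ (z k)) ^ (τ k : ℕ))) := fun z => by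
    rw [ENNReal.toReal_ofReal (vandermondeSq_nonneg z), Complex.real_smul, ofReal_vandermondeSq,
      Finset.sum_mul]
    refine Finset.sum_congr rfl fun σ _ => ?_
    rw [Finset.sum_mul]
    refine Finset.sum_congr rfl fun τ _ => ?_
    rw [Finset.prod_mul_distrib (f := fun k => h ‖z k‖)]
    ring
  have hint : ∀ k : Fin N, ∀ a b : ℕ,
      Integrable (fun w : ℂ => h ‖w‖ * (w ^ a * (starRingEnd ℂ w) ^ b)) (gaussianWeight N) :=
    fun k a b => by
    refine ((integrable_norm_pow_gaussianWeight (Fin.pos k) (a + b)).const_mul M).mono'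
      (hm.aestronglyMeasurable.mul (by fun_prop)) (ae_of_all _ fun w => ?_)
    rw [norm_mul, norm_mul, norm_pow, norm_pow, RCLike.norm_conj, ← pow_add]
    gcongr
    exact hM _
  have hintp : ∀ σ τ : Equiv.Perm (Fin N), Integrable (fun z : Fin N → ℂ =>
      ((Equiv.Perm.sign σ : ℤ) : ℂ) * ((Equiv.Perm.sign τ : ℤ) : ℂ) *
        ∏ k, (h ‖z k‖ * (z k ^ (σ k : ℕ) * (starRingEnd ℂ (z k)) ^ (τ k : ℕ))))
      (Measure.pi fun _ : Fin N => gaussianWeight N) := fun σ τ =>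
    (Integrable.fintype_prod (f := fun k w =>
      h ‖w‖ * (w ^ (σ k : ℕ) * (starRingEnd ℂ w) ^ (τ k : ℕ)))
      fun k => hint k (σ k) (τ k)).const_mul _
  simp only [hexp]
  rw [integral_finsetSum _ fun σ _ => integrable_finsetSum _ fun τ _ => hintp σ τ]
  have hσ : ∀ σ : Equiv.Perm (Fin N), ∫ z : Fin N → ℂ, ∑ τ : Equiv.Perm (Fin N),
      ((Equiv.Perm.sign σ : ℤ) : ℂ) * ((Equiv.Perm.sign τ : ℤ) : ℂ) *
        ∏ k, (h ‖z k‖ * (z k ^ (σ k : ℕ) * (starRingEnd ℂ (z k)) ^ (τ k : ℕ)))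
      ∂(Measure.pi fun _ : Fin N => gaussianWeight N) =
      ∏ i : Fin N, ∫ z, ‖z‖ ^ (2 * (i : ℕ)) • h ‖z‖ ∂(gaussianWeight N) := fun σ => by
    rw [integral_finsetSum _ fun τ _ => hintp σ τ]
    simp only [integral_const_mul]
    have hprod : ∀ τ : Equiv.Perm (Fin N), ∫ z : Fin N → ℂ,
        ∏ k, (h ‖z k‖ * (z k ^ (σ k : ℕ) * (starRingEnd ℂ (z k)) ^ (τ k : ℕ)))
        ∂(Measure.pi fun _ : Fin N => gaussianWeight N) =
        ∏ k, ∫ w, h ‖w‖ * (w ^ (σ k : ℕ) * (starRingEnd ℂ w) ^ (τ k : ℕ))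
          ∂(gaussianWeight N) := fun τ =>
      integral_fintype_prod_eq_prod (fun k w =>
        h ‖w‖ * (w ^ (σ k : ℕ) * (starRingEnd ℂ w) ^ (τ k : ℕ)))
    -- If τ ≠ σ, some coordinate carries unequal exponents and its factor vanishes. The term τ = σ
    -- has sign 1 and, after reindexing by σ, does not depend on σ; hence the factor N!.
    rw [Finset.sum_eq_single σ]
    · rw [hprod, ← Equiv.prod_comp σ
        (fun i : Fin N => ∫ z, ‖z‖ ^ (2 * (i : ℕ)) • h ‖z‖ ∂(gaussianWeight N))]
      have hs : ((Equiv.Perm.sign σ : ℤ) : ℂ) * ((Equiv.Perm.sign σ : ℤ) : ℂ) = 1 := by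
        rw [← Int.cast_mul, ← Units.val_mul, Int.units_mul_self]
        simp
      rw [hs, one_mul]
      refine Finset.prod_congr rfl fun k _ => integral_congr_ae (ae_of_all _ fun w => ?_)
      simp only
      rw [← mul_pow, Complex.mul_conj, Complex.normSq_eq_norm_sq, Complex.real_smul, pow_mul]
      push_cast
      ring
    · intro τ _ hτ
      have hne : ∃ k, σ k ≠ τ k := by
        by_contra! hcon
        exact hτ (Equiv.ext hcon).symm
      obtain ⟨k, hk⟩ := hne
      rw [hprod, Finset.prod_eq_zero (Finset.mem_univ k), mul_zero]
      exact integral_radial_mul_pow_mul_conj_pow_eq_zero N h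
        (fun hcon => hk (Fin.ext hcon))
    · simp
  simp only [hσ, Finset.sum_const, Finset.card_univ, Fintype.card_perm, Fintype.card_fin,
    nsmul_eq_mul]

/-- Kostlan's theorem: the moduli of the Ginibre eigenvalues are, as an unordered collection,
distributed as independent variables with the laws `radialLaw N j`. -/
theorem integral_prod_ginibre {N : ℕ} {h : ℝ → ℂ} (hm : Measurable fun z : ℂ => h ‖z‖) {M : ℝ}
    (hM : ∀ r, ‖h r‖ ≤ M) :
    ∫ z, ∏ k, h ‖z k‖ ∂(ginibre N) = ∏ i : Fin N, ∫ z, h ‖z‖ ∂(radialLaw N i) := by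
  -- The constant function 1 evaluates the normalizing constant Z_N.
  have hZ := integral_prod_ginibreUnnormalized (N := N) (h := fun _ => 1) (M := 1) (by fun_prop)
    (by simp)
  have h1 : ∀ i : Fin N, ∫ z : ℂ, ‖z‖ ^ (2 * (i : ℕ)) • (1 : ℂ) ∂(gaussianWeight N) =
      ((Real.pi * (i : ℕ).factorial / (N : ℝ) ^ ((i : ℕ) + 1) : ℝ) : ℂ) := fun i => by
    rw [integral_smul_const, integral_norm_pow_gaussianWeight (Fin.pos i), Complex.real_smul,
      mul_one]
  simp only [Finset.prod_const_one, h1, integral_const] at hZ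
  rw [Complex.real_smul, mul_one] at hZ
  have hpos : ∀ i : Fin N, (Real.pi * (i : ℕ).factorial / (N : ℝ) ^ ((i : ℕ) + 1) : ℝ) ≠ 0 :=
    fun i => by
      have : (0 : ℝ) < N := by exact_mod_cast Fin.pos i
      positivity
  unfold ginibre
  rw [integral_smul_measure, integral_prod_ginibreUnnormalized hm hM, ENNReal.toReal_inv,
    ← measureReal_def, Complex.real_smul, Complex.ofReal_inv, hZ]
  simp only [integral_radialLaw, Complex.real_smul, Complex.ofReal_inv]
  rw [Finset.prod_mul_distrib, Finset.prod_inv_distrib]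
  have hp : ∏ i : Fin N, ((Real.pi * (i : ℕ).factorial / (N : ℝ) ^ ((i : ℕ) + 1) : ℝ) : ℂ) ≠ 0 :=
    Finset.prod_ne_zero_iff.2 fun i _ => by exact_mod_cast hpos i
  have hf : (N.factorial : ℂ) ≠ 0 := by exact_mod_cast N.factorial_ne_zero
  field_simp

theorem measurable_linearStatistic (N : ℕ) {F : ℂ → ℝ} (hF : Measurable F) :
    Measurable (linearStatistic N F) := by
  unfold linearStatistic
  fun_prop

theorem integral_exp_linearStatistic_ginibre (N : ℕ) {f : ℝ → ℝ} (hf : Measurable (radial f))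
    (t : ℝ) :
    ∫ z, Complex.exp ((t * linearStatistic N (radial f) z : ℝ) * Complex.I) ∂(ginibre N) =
      ∏ i : Fin N, ∫ z, Complex.exp ((t * radial f z : ℝ) * Complex.I) ∂(radialLaw N i) := by
  have hm : Measurable fun z : ℂ => Complex.exp ((t * radial f z : ℝ) * Complex.I) := by fun_prop
  have h := integral_prod_ginibre (N := N) (h := fun r => Complex.exp ((t * f r : ℝ) * Complex.I)) (M := 1) hm
    fun r => (Complex.norm_exp_ofReal_mul_I _).le
  refine Eq.trans ?_ h
  refine integral_congr_ae (ae_of_all _ fun z => ?_)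
  simp only [linearStatistic, radial]
  rw [← Complex.exp_sum]
  congr 1
  push_cast
  rw [Finset.mul_sum, Finset.sum_mul]

/-- Both characteristic functions equal the same product of one-variable integrals. Means and
variances can therefore be computed under the product measure. -/
theorem map_linearStatistic_ginibre (N : ℕ) {f : ℝ → ℝ} (hf : Measurable (radial f)) :
    (ginibre N).map (linearStatistic N (radial f)) =
      (Measure.pi (radialLaw N)).map (linearStatistic N (radial f)) := by
  have hm := measurable_linearStatistic N hf
  have := Measure.isProbabilityMeasure_map (μ := ginibre N) hm.aemeasurable
  have := Measure.isProbabilityMeasure_map (μ := Measure.pi (radialLaw N)) hm.aemeasurable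
  refine Measure.ext_of_charFun (funext fun t => ?_)
  rw [charFun_apply_real, charFun_apply_real, integral_map hm.aemeasurable (by fun_prop),
    integral_map hm.aemeasurable (by fun_prop)]
  have h1 := integral_exp_linearStatistic_ginibre N hf t
  simp only [Complex.ofReal_mul] at h1
  rw [h1, ← integral_fintype_prod_eq_prod
    (fun _ w => Complex.exp ((t : ℂ) * (radial f w : ℝ) * Complex.I))]
  refine integral_congr_ae (ae_of_all _ fun z => ?_)
  simp only [linearStatistic]
  rw [← Complex.exp_sum]
  congr 1
  push_cast
  rw [Finset.mul_sum, Finset.sum_mul]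

theorem memLp_of_abs_le {Ω : Type*} [MeasurableSpace Ω] {μ : Measure Ω} [IsFiniteMeasure μ]
    {X : Ω → ℝ} (hX : Measurable X) {M : ℝ} (hM : ∀ ω, |X ω| ≤ M) (p : ℝ≥0∞) : MemLp X p μ :=
  MemLp.of_bound hX.aestronglyMeasurable M (ae_of_all _ hM)

theorem variance_linearStatistic_ginibre (N : ℕ) {f : ℝ → ℝ} (hf : Measurable (radial f))
    {M : ℝ} (hM : ∀ z, |radial f z| ≤ M) :
    Var[linearStatistic N (radial f); ginibre N] =
      ∑ i : Fin N, Var[radial f; radialLaw N i] := by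
  have hm := measurable_linearStatistic N hf
  rw [← variance_id_map hm.aemeasurable, map_linearStatistic_ginibre N hf,
    variance_id_map hm.aemeasurable, ← variance_sum_pi (μ := radialLaw N)
      (X := fun _ => radial f) fun i => memLp_of_abs_le hf hM 2]
  congr 1
  funext z
  simp [linearStatistic]

theorem integral_linearStatistic_ginibre (N : ℕ) {f : ℝ → ℝ} (hf : Measurable (radial f))
    {M : ℝ} (hM : ∀ z, |radial f z| ≤ M) :
    ∫ z, linearStatistic N (radial f) z ∂(ginibre N) =
      ∑ i : Fin N, ∫ z, radial f z ∂(radialLaw N i) := by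
  have hm := measurable_linearStatistic N hf
  have h1 := integral_map (μ := ginibre N) hm.aemeasurable
    (f := fun x : ℝ => x) (by fun_prop)
  have h2 := integral_map (μ := Measure.pi (radialLaw N)) hm.aemeasurable
    (f := fun x : ℝ => x) (by fun_prop)
  rw [← h1, map_linearStatistic_ginibre N hf, h2]
  unfold linearStatistic
  rw [integral_finsetSum]
  · refine Finset.sum_congr rfl fun i _ => ?_
    exact integral_comp_eval (μ := radialLaw N) hf.aestronglyMeasurable
  · intro i _
    exact Integrable.of_bound (hf.comp (measurable_pi_apply i)).aestronglyMeasurable M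
      (ae_of_all _ fun z => hM (z i))

/-! ### Central moments of the squared modulus -/

theorem sq_norm_sub_pow_eq_sum (c : ℝ) (k : ℕ) (z : ℂ) : (‖z‖ ^ 2 - c) ^ k =
    ∑ m ∈ Finset.range (k + 1), (-c) ^ (k - m) * (k.choose m) * ‖z‖ ^ (2 * m) := by
  rw [sub_eq_add_neg, add_pow]
  refine Finset.sum_congr rfl fun m _ => ?_
  rw [pow_mul]
  ring

theorem integrable_sq_norm_sub_pow_radialLaw (N : ℕ) (j : Fin N) (c : ℝ) (k : ℕ) :
    Integrable (fun z : ℂ => (‖z‖ ^ 2 - c) ^ k) (radialLaw N j) := by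
  simp only [sq_norm_sub_pow_eq_sum]
  exact integrable_finsetSum _ fun m _ => (integrable_norm_pow_radialLaw N j (2 * m)).const_mul _

theorem integral_sq_norm_sub_pow_radialLaw (N : ℕ) (j : Fin N) (c : ℝ) (k : ℕ) :
    ∫ z, (‖z‖ ^ 2 - c) ^ k ∂(radialLaw N j) =
      ∑ m ∈ Finset.range (k + 1), (-c) ^ (k - m) * (k.choose m) *
        (((j : ℕ) + m).factorial / ((j : ℕ).factorial * (N : ℝ) ^ m)) := by
  simp only [sq_norm_sub_pow_eq_sum]
  rw [integral_finsetSum _ fun m _ => (integrable_norm_pow_radialLaw N j (2 * m)).const_mul _]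
  simp only [integral_const_mul, integral_norm_pow_radialLaw]

theorem centralMoments_sq_norm_radialLaw (N : ℕ) (j : Fin N) :
    ∫ z, (‖z‖ ^ 2 - ((j : ℕ) + 1 : ℝ) / N) ∂(radialLaw N j) = 0 ∧
    ∫ z, (‖z‖ ^ 2 - ((j : ℕ) + 1 : ℝ) / N) ^ 2 ∂(radialLaw N j) = ((j : ℕ) + 1 : ℝ) / (N : ℝ) ^ 2 ∧
    ∫ z, (‖z‖ ^ 2 - ((j : ℕ) + 1 : ℝ) / N) ^ 4 ∂(radialLaw N j) =
      (3 * ((j : ℕ) + 1 : ℝ) ^ 2 + 6 * ((j : ℕ) + 1 : ℝ)) / (N : ℝ) ^ 4 := by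
  have hN' : (0 : ℝ) < N := by exact_mod_cast Fin.pos j
  have hf : ((j : ℕ).factorial : ℝ) ≠ 0 := by exact_mod_cast (j : ℕ).factorial_ne_zero
  have h1 := integral_sq_norm_sub_pow_radialLaw N j (((j : ℕ) + 1 : ℝ) / N) 1
  simp only [pow_one] at h1
  rw [h1, integral_sq_norm_sub_pow_radialLaw, integral_sq_norm_sub_pow_radialLaw]
  simp only [Finset.sum_range_succ, Finset.sum_range_zero, Nat.choose, Nat.factorial_succ,
    add_zero, zero_add, show (j : ℕ) + 2 = (j : ℕ) + 1 + 1 from rfl,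
    show (j : ℕ) + 3 = (j : ℕ) + 1 + 1 + 1 from rfl,
    show (j : ℕ) + 4 = (j : ℕ) + 1 + 1 + 1 + 1 from rfl]
  push_cast
  refine ⟨?_, ?_, ?_⟩
  · field_simp
    ring
  · field_simp
    ring
  · field_simp
    ring

theorem ae_norm_pos_radialLaw (N : ℕ) (j : Fin N) : ∀ᵐ z ∂(radialLaw N j), 0 < ‖z‖ := by
  have h : radialLaw N j ≪ (volume : Measure ℂ) :=
    (withDensity_absolutelyContinuous _ _).trans (withDensity_absolutelyContinuous _ _)
  refine h.ae_le ?_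
  have h0 : ∀ᵐ z : ℂ, z ≠ 0 := compl_mem_ae_iff.2 (measure_singleton 0)
  filter_upwards [h0] with z hz
  exact norm_pos_iff.2 hz

/-! ### Moment estimates for one radial variable -/

/-- Bounded profiles which are `C¹` on `(0, 1]` and satisfy, at the points of `(0, 1]`, a uniform
first-order Taylor estimate on the whole half-line. -/
structure IsTaylorProfile (f : ℝ → ℝ) : Prop where
  measurable : Measurable (radial f)
  bounded : ∃ M, ∀ r, 0 ≤ r → |f r| ≤ M
  differentiableAt : ∀ a ∈ Ioc (0 : ℝ) 1, DifferentiableAt ℝ f a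
  continuousOn_deriv : ContinuousOn (deriv f) (Ioc 0 1)
  taylor : ∃ L, 0 ≤ L ∧ ∀ a ∈ Ioc (0 : ℝ) 1, |deriv f a| ≤ L ∧ ∀ r, 0 < r →
    |f r - f a| ≤ L * |r - a| ∧ |f r - f a - deriv f a * (r - a)| ≤ L * (r - a) ^ 2

theorem abs_sub_le_abs_sq_sub_sq_div {r a : ℝ} (hr : 0 ≤ r) (ha : 0 < a) :
    |r - a| ≤ |r ^ 2 - a ^ 2| / a := by
  rw [le_div_iff₀ ha, show r ^ 2 - a ^ 2 = (r - a) * (r + a) by ring, abs_mul,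
    abs_of_pos (by linarith : 0 < r + a)]
  gcongr
  linarith

/-- This passes from a Taylor estimate in r to one in r², the variable whose central moments are
explicit, through r - a = (r² - a²)/(2a) - (r - a)²/(2a). -/
theorem abs_sub_sub_mul_sq_sub_sq_le {L D d r a : ℝ} (hL : 0 ≤ L) (hr : 0 ≤ r) (ha : 0 < a)
    (ha1 : a ≤ 1) (hd : |d| ≤ L) (hD : |D - d * (r - a)| ≤ L * (r - a) ^ 2) :
    |D - d / (2 * a) * (r ^ 2 - a ^ 2)| ≤ 2 * L / a ^ 3 * (r ^ 2 - a ^ 2) ^ 2 := by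
  have h1 : D - d / (2 * a) * (r ^ 2 - a ^ 2) =
      (D - d * (r - a)) + -(d / (2 * a)) * (r - a) ^ 2 := by
    field_simp
    ring
  have h2 : (r - a) ^ 2 ≤ (r ^ 2 - a ^ 2) ^ 2 / a ^ 2 := by
    have := abs_sub_le_abs_sq_sub_sq_div hr ha
    have h := pow_le_pow_left₀ (abs_nonneg _) this 2
    rwa [div_pow, sq_abs, sq_abs] at h
  rw [h1]
  refine (abs_add_le _ _).trans ?_
  rw [abs_mul, abs_neg, abs_div, abs_of_pos (by positivity : 0 < 2 * a), abs_sq]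
  have h3 : |d| / (2 * a) ≤ L / a := by
    gcongr
    linarith
  have h4 : L ≤ L / a := by
    rw [le_div_iff₀ ha]
    nlinarith
  calc _ ≤ L / a * (r - a) ^ 2 + L / a * (r - a) ^ 2 := by
        gcongr
        exact hD.trans (by gcongr)
    _ = 2 * L / a * (r - a) ^ 2 := by ring
    _ ≤ 2 * L / a * ((r ^ 2 - a ^ 2) ^ 2 / a ^ 2) := by gcongr
    _ = _ := by field_simp

/-- Allows centering at a convenient constant c instead of the mean. With D = X - c and d = E[D], it
uses (D - d)⁴ ≤ 8D⁴ + 8d⁴ and d² ≤ E[D²]. -/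
theorem variance_and_fourth_moment_of_abs_le {Ω : Type*} [MeasurableSpace Ω] (μ : Measure Ω)
    [IsProbabilityMeasure μ] {X : Ω → ℝ} (hX : Measurable X) {M : ℝ} (hM : ∀ ω, |X ω| ≤ M)
    (c : ℝ) :
    Var[X; μ] = ∫ ω, (X ω - c) ^ 2 ∂μ - (∫ ω, (X ω - c) ∂μ) ^ 2 ∧
    ∫ ω, (X ω - ∫ ω', X ω' ∂μ) ^ 4 ∂μ ≤
      8 * ∫ ω, (X ω - c) ^ 4 ∂μ + 8 * (∫ ω, (X ω - c) ^ 2 ∂μ) ^ 2 := by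
  set D : Ω → ℝ := fun ω => X ω - c with hD
  have hDm : Measurable D := hX.sub_const _
  have hDb : ∀ ω, |D ω| ≤ M + |c| := fun ω => (abs_sub _ _).trans (by gcongr; exact hM ω)
  have hDi : ∀ k : ℕ, Integrable (fun ω => D ω ^ k) μ := fun k =>
    Integrable.of_bound (hDm.pow_const k).aestronglyMeasurable ((M + |c|) ^ k)
      (ae_of_all _ fun ω => by
        rw [norm_pow]
        exact pow_le_pow_left₀ (norm_nonneg _) (hDb ω) k)
  have hvar : Var[X; μ] = ∫ ω, D ω ^ 2 ∂μ - (∫ ω, D ω ∂μ) ^ 2 := by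
    rw [← variance_sub_const hX.aestronglyMeasurable c,
      variance_eq_sub (memLp_of_abs_le hDm hDb 2)]
    rfl
  refine ⟨hvar, ?_⟩
  set d : ℝ := ∫ ω, D ω ∂μ with hd
  have hmean : ∫ ω, X ω ∂μ = c + d := by
    rw [hd, hD, integral_sub (Integrable.of_bound hX.aestronglyMeasurable M
      (ae_of_all _ hM)) (integrable_const _)]
    simp
  have hd2 : d ^ 2 ≤ ∫ ω, D ω ^ 2 ∂μ := by
    have := variance_nonneg X μ
    linarith
  calc ∫ ω, (X ω - ∫ ω', X ω' ∂μ) ^ 4 ∂μ ≤ ∫ ω, (8 * D ω ^ 4 + 8 * (d ^ 2) ^ 2) ∂μ := by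
        refine integral_mono_of_nonneg (ae_of_all _ fun ω => by positivity)
          (((hDi 4).const_mul 8).add (integrable_const _)) (ae_of_all _ fun ω => ?_)
        have e : X ω - ∫ ω', X ω' ∂μ = D ω - d := by simp only [hmean, hD]; ring
        have e1 : (D ω - d) ^ 2 ≤ 2 * (D ω ^ 2 + d ^ 2) := by nlinarith [sq_nonneg (D ω + d)]
        have e2 := pow_le_pow_left₀ (sq_nonneg _) e1 2
        change (X ω - ∫ ω', X ω' ∂μ) ^ 4 ≤ 8 * D ω ^ 4 + 8 * (d ^ 2) ^ 2
        rw [e]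
        nlinarith [sq_nonneg (D ω ^ 2 - d ^ 2)]
    _ = 8 * ∫ ω, D ω ^ 4 ∂μ + 8 * (d ^ 2) ^ 2 := by
        rw [integral_add ((hDi 4).const_mul 8) (integrable_const _), integral_const_mul]
        simp
    _ ≤ _ := by gcongr

/-- With T = D - Y one has D² - Y² = T² + 2TY, and 2|TY| ≤ ηT² + Y²/η. -/
theorem abs_integral_sq_sub_integral_sq_le {Ω : Type*} [MeasurableSpace Ω] (μ : Measure Ω)
    {D Y B : Ω → ℝ} (hD : Integrable (fun ω => D ω ^ 2) μ) (hY : Integrable (fun ω => Y ω ^ 2) μ)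
    (hB : Integrable (fun ω => B ω ^ 2) μ) (h : ∀ᵐ ω ∂μ, |D ω - Y ω| ≤ B ω) {η : ℝ}
    (hη : 0 < η) :
    |∫ ω, D ω ^ 2 ∂μ - ∫ ω, Y ω ^ 2 ∂μ| ≤
      (1 + η) * ∫ ω, B ω ^ 2 ∂μ + 1 / η * ∫ ω, Y ω ^ 2 ∂μ := by
  rw [← integral_sub hD hY, ← integral_const_mul, ← integral_const_mul,
    ← integral_add (hB.const_mul _) (hY.const_mul _)]
  rw [← Real.norm_eq_abs]
  refine norm_integral_le_of_norm_le ((hB.const_mul (1 + η)).add (hY.const_mul (1 / η))) ?_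
  filter_upwards [h] with ω hω
  have h2 := pow_le_pow_left₀ (abs_nonneg _) hω 2
  rw [sq_abs] at h2
  set T := D ω - Y ω with hT
  have hDT : D ω = Y ω + T := by rw [hT]; ring
  have p1 : 0 ≤ η * T ^ 2 + 1 / η * Y ω ^ 2 - 2 * (T * Y ω) := by
    have : η * T ^ 2 + 1 / η * Y ω ^ 2 - 2 * (T * Y ω) = (η * T - Y ω) ^ 2 / η := by
      field_simp; ring
    rw [this]; positivity
  have p2 : 0 ≤ η * T ^ 2 + 1 / η * Y ω ^ 2 + 2 * (T * Y ω) := by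
    have : η * T ^ 2 + 1 / η * Y ω ^ 2 + 2 * (T * Y ω) = (η * T + Y ω) ^ 2 / η := by
      field_simp; ring
    rw [this]; positivity
  have key : |D ω ^ 2 - Y ω ^ 2| ≤ (1 + η) * T ^ 2 + 1 / η * Y ω ^ 2 := by
    rw [hDT, abs_le]
    constructor <;> nlinarith [sq_nonneg T]
  rw [Real.norm_eq_abs]
  refine key.trans ?_
  gcongr

theorem radialLaw_moment_estimates {f : ℝ → ℝ} (hf : Measurable (radial f)) {M : ℝ}
    (hM : ∀ z, |radial f z| ≤ M) {L : ℝ} (hL : 0 ≤ L) {N : ℕ} {j : Fin N} {a b : ℝ} (ha0 : 0 < a)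
    (ha1 : a ≤ 1) (ha2 : a ^ 2 = ((j : ℕ) + 1 : ℝ) / N) (hb : |b| ≤ L)
    (hT : ∀ r, 0 < r → |f r - f a| ≤ L * |r - a| ∧
      |f r - f a - b * (r - a)| ≤ L * (r - a) ^ 2) :
    ∫ z, (radial f z - f a) ^ 2 ∂(radialLaw N j) ≤ L ^ 2 / N ∧
    ∫ z, (radial f z - f a) ^ 4 ∂(radialLaw N j) ≤ 9 * L ^ 4 / (N : ℝ) ^ 2 ∧
    (∫ z, (radial f z - f a) ∂(radialLaw N j)) ^ 2 ≤ 4 * L ^ 2 / (N * √((j : ℕ) + 1 : ℝ)) ∧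
    |∫ z, (radial f z - f a) ^ 2 ∂(radialLaw N j) - b ^ 2 / (4 * N)| ≤
      73 * L ^ 2 / (N * √((j : ℕ) + 1 : ℝ)) := by
  have hN' : (0 : ℝ) < N := by exact_mod_cast Fin.pos j
  obtain ⟨e1, e2, e4⟩ := centralMoments_sq_norm_radialLaw N j
  have hi := integrable_sq_norm_sub_pow_radialLaw N j (a ^ 2)
  have hpos := ae_norm_pos_radialLaw N j
  have hs1 : 1 ≤ √((j : ℕ) + 1 : ℝ) := Real.one_le_sqrt.2 (by simp)
  have hss : ((j : ℕ) + 1 : ℝ) = √((j : ℕ) + 1 : ℝ) ^ 2 := (Real.sq_sqrt (by positivity)).symm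
  rw [← ha2] at e1 e2 e4
  generalize √((j : ℕ) + 1 : ℝ) = s at hs1 hss ⊢
  rw [hss] at ha2 e2 e4
  have hprob : IsProbabilityMeasure (radialLaw N j) := inferInstance
  generalize radialLaw N j = ν at *
  have hs0 : 0 < s := by linarith
  -- Here s² = j + 1 ≥ 1, so 3s⁴ + 6s² ≤ 9s⁴.
  have e4' : ∫ z, (‖z‖ ^ 2 - a ^ 2) ^ 4 ∂ν ≤ 9 * s ^ 4 / (N : ℝ) ^ 4 := by
    rw [e4]
    gcongr
    nlinarith [one_le_pow₀ hs1 (n := 2)]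
  set D : ℂ → ℝ := fun z => radial f z - f a with hD
  have hDm : Measurable D := hf.sub_const _
  have hDi : ∀ k : ℕ, Integrable (fun z => D z ^ k) ν := fun k =>
    Integrable.of_bound (hDm.pow_const k).aestronglyMeasurable ((M + |f a|) ^ k)
      (ae_of_all _ fun z => by
        rw [norm_pow]
        exact pow_le_pow_left₀ (norm_nonneg _) ((abs_sub _ _).trans (by gcongr; exact hM z)) k)
  have hDi1 : Integrable D ν := by simpa using hDi 1
  have hD1 : ∀ᵐ z ∂ν, |D z| ≤ L / a * |‖z‖ ^ 2 - a ^ 2| := by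
    filter_upwards [hpos] with z hz
    refine (hT _ hz).1.trans ?_
    calc L * |‖z‖ - a| ≤ L * (|‖z‖ ^ 2 - a ^ 2| / a) := by
          gcongr
          exact abs_sub_le_abs_sq_sub_sq_div hz.le ha0
      _ = _ := by ring
  have hD2 : ∫ z, D z ^ 2 ∂ν ≤ L ^ 2 / N := by
    calc ∫ z, D z ^ 2 ∂ν ≤ ∫ z, (L / a) ^ 2 * (‖z‖ ^ 2 - a ^ 2) ^ 2 ∂ν := by
          refine integral_mono_ae (hDi 2) ((hi 2).const_mul _) ?_
          filter_upwards [hD1] with z hz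
          have h := pow_le_pow_left₀ (abs_nonneg _) hz 2
          rwa [mul_pow, sq_abs, sq_abs] at h
      _ = L ^ 2 / N := by
          rw [integral_const_mul, e2, div_pow, ha2]
          field_simp
  have hD4 : ∫ z, D z ^ 4 ∂ν ≤ 9 * L ^ 4 / (N : ℝ) ^ 2 := by
    calc ∫ z, D z ^ 4 ∂ν ≤ ∫ z, (L / a) ^ 4 * (‖z‖ ^ 2 - a ^ 2) ^ 4 ∂ν := by
          refine integral_mono_ae (hDi 4) ((hi 4).const_mul _) ?_
          filter_upwards [hD1] with z hz
          have h := pow_le_pow_left₀ (abs_nonneg _) hz 4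
          rwa [mul_pow, ← abs_pow, ← abs_pow, abs_of_nonneg (by positivity : 0 ≤ D z ^ 4),
            abs_of_nonneg (by positivity : 0 ≤ (‖z‖ ^ 2 - a ^ 2) ^ 4)] at h
      _ ≤ (L / a) ^ 4 * (9 * s ^ 4 / (N : ℝ) ^ 4) := by
          rw [integral_const_mul]
          gcongr
      _ = 9 * L ^ 4 / (N : ℝ) ^ 2 := by
          rw [div_pow, show a ^ 4 = (a ^ 2) ^ 2 by ring, ha2]
          field_simp
  -- The linear part of D in the variable |z|²: it has mean 0 and second moment exactly b²/(4N).
  set Y : ℂ → ℝ := fun z => b / (2 * a) * (‖z‖ ^ 2 - a ^ 2) with hY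
  have hi1 : Integrable (fun z : ℂ => ‖z‖ ^ 2 - a ^ 2) ν := by simpa using hi 1
  have hYi : Integrable Y ν := hi1.const_mul _
  have hYi2 : Integrable (fun z => Y z ^ 2) ν := by
    simp only [hY, mul_pow]
    exact (hi 2).const_mul _
  have hYint : ∫ z, Y z ∂ν = 0 := by
    rw [hY, integral_const_mul, e1, mul_zero]
  have hYint2 : ∫ z, Y z ^ 2 ∂ν = b ^ 2 / (4 * N) := by
    simp only [hY, mul_pow]
    rw [integral_const_mul, e2, div_pow, mul_pow, ha2]
    field_simp
    norm_num
  have hTb : ∀ᵐ z ∂ν, |D z - Y z| ≤ 2 * L / a ^ 3 * (‖z‖ ^ 2 - a ^ 2) ^ 2 := by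
    filter_upwards [hpos] with z hz
    exact abs_sub_sub_mul_sq_sub_sq_le hL hz.le ha0 ha1 hb (hT _ hz).2
  refine ⟨hD2, hD4, ?_, ?_⟩
  -- Since Y has mean zero, only the quadratic remainder contributes to the mean of D.
  · have h1 : |∫ z, D z ∂ν| ≤ 2 * L / (a * N) := by
      calc |∫ z, D z ∂ν| = |∫ z, (D z - Y z) ∂ν| := by rw [integral_sub hDi1 hYi, hYint, sub_zero]
        _ ≤ ∫ z, 2 * L / a ^ 3 * (‖z‖ ^ 2 - a ^ 2) ^ 2 ∂ν := by
          rw [← Real.norm_eq_abs]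
          exact norm_integral_le_of_norm_le ((hi 2).const_mul _) hTb
        _ = 2 * L / (a * N) := by
          rw [integral_const_mul, e2, show a ^ 3 = a ^ 2 * a by ring, ha2]
          field_simp
    have h2 := pow_le_pow_left₀ (abs_nonneg _) h1 2
    rw [sq_abs] at h2
    calc (∫ z, D z ∂ν) ^ 2 ≤ (2 * L / (a * N)) ^ 2 := h2
      _ = 4 * L ^ 2 / (N * s ^ 2) := by
          rw [div_pow, mul_pow, mul_pow, ha2]
          field_simp
          ring
      _ ≤ _ := by
          gcongr
          nlinarith
  · have hb2 : b ^ 2 ≤ L ^ 2 := by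
      rw [← sq_abs]
      exact pow_le_pow_left₀ (abs_nonneg _) hb 2
    have hBsq : ∀ z : ℂ, (2 * L / a ^ 3 * (‖z‖ ^ 2 - a ^ 2) ^ 2) ^ 2 =
        (2 * L / a ^ 3) ^ 2 * (‖z‖ ^ 2 - a ^ 2) ^ 4 := fun z => by ring
    -- Taking η = s = √(j + 1) makes both error terms of order L²/(Ns). With 1 + s ≤ 2s the constant
    -- is 2·4·9 + 1 = 73.
    have h := abs_integral_sq_sub_integral_sq_le ν (hDi 2) hYi2
      (by simp only [hBsq]; exact (hi 4).const_mul _) hTb hs0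
    simp only [hBsq] at h
    rw [hYint2, integral_const_mul] at h
    refine h.trans ?_
    calc _ ≤ (2 * s) * ((2 * L / a ^ 3) ^ 2 * (9 * s ^ 4 / (N : ℝ) ^ 4)) +
          1 / s * (L ^ 2 / N) := by
          gcongr
          · linarith
          · linarith
      _ = 73 * L ^ 2 / (N * s) := by
          rw [div_pow, show (a ^ 3) ^ 2 = (a ^ 2) ^ 3 by ring, ha2]
          field_simp
          ring

theorem IsTaylorProfile.radialLaw_estimates {f : ℝ → ℝ} (hf : IsTaylorProfile f) :
    ∃ K, ∀ (N : ℕ) (j : Fin N),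
      Var[radial f; radialLaw N j] ≤ K / N ∧
      ∫ z, (radial f z - ∫ w, radial f w ∂(radialLaw N j)) ^ 4 ∂(radialLaw N j) ≤
        K / (N : ℝ) ^ 2 ∧
      |Var[radial f; radialLaw N j] - deriv f (√(((j : ℕ) + 1 : ℝ) / N)) ^ 2 / (4 * N)| ≤
        K / (N * √((j : ℕ) + 1 : ℝ)) := by
  obtain ⟨L, hL, hT⟩ := hf.taylor
  obtain ⟨M, hM⟩ := hf.bounded
  have hMr : ∀ z, |radial f z| ≤ M := fun z => hM _ (norm_nonneg z)
  -- The fourth moment costs 8·9 + 8 = 80 times L⁴; the variance error costs 73 + 4 = 77 times L².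
  refine ⟨80 * (L ^ 2 + L ^ 4), fun N j => ?_⟩
  have hN' : (0 : ℝ) < N := by exact_mod_cast Fin.pos j
  set a : ℝ := √(((j : ℕ) + 1 : ℝ) / N) with ha
  have ha0 : 0 < a := Real.sqrt_pos.2 (by positivity)
  have ha2 : a ^ 2 = ((j : ℕ) + 1 : ℝ) / N := Real.sq_sqrt (by positivity)
  have ha1 : a ≤ 1 := by
    rw [ha, Real.sqrt_le_one, div_le_one hN']
    exact_mod_cast j.2
  obtain ⟨hd, hT⟩ := hT a ⟨ha0, ha1⟩
  obtain ⟨h1, h2, h3, h4⟩ :=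
    radialLaw_moment_estimates hf.measurable hMr hL ha0 ha1 ha2 hd hT
  obtain ⟨hv, hw⟩ :=
    variance_and_fourth_moment_of_abs_le (radialLaw N j) hf.measurable hMr (f a)
  have hL4 : 0 ≤ L ^ 4 := by positivity
  have hL2 : 0 ≤ L ^ 2 := by positivity
  refine ⟨?_, ?_, ?_⟩
  · calc _ ≤ L ^ 2 / N := by rw [hv]; nlinarith [sq_nonneg (∫ z, (radial f z - f a) ∂(radialLaw N j))]
      _ ≤ _ := by
        gcongr
        linarith
  · refine hw.trans ?_
    calc _ ≤ 8 * (9 * L ^ 4 / (N : ℝ) ^ 2) + 8 * (L ^ 2 / N) ^ 2 := by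
          have : 0 ≤ ∫ z, (radial f z - f a) ^ 2 ∂(radialLaw N j) :=
            integral_nonneg fun _ => sq_nonneg _
          gcongr
      _ = 80 * L ^ 4 / (N : ℝ) ^ 2 := by
          field_simp
          ring
      _ ≤ _ := by
        gcongr
        linarith
  · rw [hv, sub_right_comm]
    refine (abs_sub _ _).trans ?_
    rw [abs_sq]
    calc _ ≤ 73 * L ^ 2 / (N * √((j : ℕ) + 1 : ℝ)) + 4 * L ^ 2 / (N * √((j : ℕ) + 1 : ℝ)) :=
          add_le_add h4 h3
      _ = 77 * L ^ 2 / (N * √((j : ℕ) + 1 : ℝ)) := by ring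
      _ ≤ _ := by
        gcongr <;> linarith

/-! ### Sums of Taylor profiles, and test functions as Taylor profiles -/

theorem IsTaylorProfile.add {f g : ℝ → ℝ} (hf : IsTaylorProfile f) (hg : IsTaylorProfile g) :
    IsTaylorProfile (f + g) := by
  obtain ⟨Lf, hLf, hTf⟩ := hf.taylor
  obtain ⟨Lg, hLg, hTg⟩ := hg.taylor
  obtain ⟨Mf, hMf⟩ := hf.bounded
  obtain ⟨Mg, hMg⟩ := hg.bounded
  have hd : ∀ a ∈ Ioc (0 : ℝ) 1, deriv (f + g) a = deriv f a + deriv g a := fun a ha =>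
    deriv_add (hf.differentiableAt a ha) (hg.differentiableAt a ha)
  refine ⟨hf.measurable.add hg.measurable, ⟨Mf + Mg, fun r hr => ?_⟩,
    fun a ha => (hf.differentiableAt a ha).add (hg.differentiableAt a ha),
    (hf.continuousOn_deriv.add hg.continuousOn_deriv).congr hd,
    ⟨Lf + Lg, by positivity, fun a ha => ⟨?_, fun r hr => ⟨?_, ?_⟩⟩⟩⟩
  · exact (abs_add_le _ _).trans (add_le_add (hMf r hr) (hMg r hr))
  · rw [hd a ha]
    exact (abs_add_le _ _).trans (add_le_add (hTf a ha).1 (hTg a ha).1)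
  · rw [Pi.add_apply, Pi.add_apply, add_mul, add_sub_add_comm]
    exact (abs_add_le _ _).trans (add_le_add ((hTf a ha).2 r hr).1 ((hTg a ha).2 r hr).1)
  · rw [hd a ha, Pi.add_apply, Pi.add_apply, add_mul, add_mul, add_sub_add_comm, add_sub_add_comm]
    exact (abs_add_le _ _).trans (add_le_add ((hTf a ha).2 r hr).2 ((hTg a ha).2 r hr).2)

/-- For r < 1 + ε the bounds on f' and f'' give the estimates by the mean value inequality. For r ≥
1 + ε only boundedness of f is known, but then r - a ≥ ε, and constants are absorbed into powers of
(r - a)/ε. -/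
theorem IsRadialTest.isTaylorProfile {δ : ℝ≥0} {ε : ℝ} (hε : 0 < ε) {f : ℝ → ℝ}
    (hf : IsRadialTest δ ε f) : IsTaylorProfile f := by
  obtain ⟨M, hM⟩ := hf.bounded
  have hC := hf.memC2Holder.contDiffOn
  obtain ⟨M₁, hM₁⟩ := hf.memC2Holder.bounded 1 (by norm_num)
  obtain ⟨M₂, hM₂⟩ := hf.memC2Holder.bounded 2 le_rfl
  have hopen : IsOpen (Ioo 0 (1 + ε)) := isOpen_Ioo
  have hdiff : ∀ x ∈ Ioo 0 (1 + ε), DifferentiableAt ℝ f x := fun x hx =>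
    (hC.differentiableOn (by norm_num)).differentiableAt (hopen.mem_nhds hx)
  have hC1 : ContDiffOn ℝ 1 (deriv f) (Ioo 0 (1 + ε)) := hC.deriv_of_isOpen hopen (by norm_num)
  have hdiff1 : ∀ x ∈ Ioo 0 (1 + ε), DifferentiableAt ℝ (deriv f) x := fun x hx =>
    (hC1.differentiableOn (by norm_num)).differentiableAt (hopen.mem_nhds hx)
  have hb₁ : ∀ x ∈ Ioo 0 (1 + ε), |deriv f x| ≤ M₁ := fun x hx => by
    have h := hM₁ x hx
    rwa [iteratedDerivWithin_of_isOpen hopen hx, iteratedDeriv_one] at h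
  have hb₂ : ∀ x ∈ Ioo 0 (1 + ε), |deriv (deriv f) x| ≤ M₂ := fun x hx => by
    have h := hM₂ x hx
    rwa [iteratedDerivWithin_of_isOpen hopen hx, iteratedDeriv_succ, iteratedDeriv_one] at h
  have hsub : Ioc (0 : ℝ) 1 ⊆ Ioo 0 (1 + ε) := fun x hx => ⟨hx.1, by linarith [hx.2]⟩
  have h1 : (1 : ℝ) ∈ Ioo 0 (1 + ε) := hsub (by simp)
  have hM0 : 0 ≤ M := (abs_nonneg _).trans (hM 0 le_rfl)
  have hM₁0 : 0 ≤ M₁ := (abs_nonneg _).trans (hb₁ 1 h1)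
  have hM₂0 : 0 ≤ M₂ := (abs_nonneg _).trans (hb₂ 1 h1)
  have hLip : ∀ x ∈ Ioo 0 (1 + ε), ∀ y ∈ Ioo 0 (1 + ε), |f y - f x| ≤ M₁ * |y - x| :=
    fun x hx y hy => (convex_Ioo 0 (1 + ε)).norm_image_sub_le_of_norm_deriv_le hdiff hb₁ hx hy
  have hLip' : ∀ x ∈ Ioo 0 (1 + ε), ∀ y ∈ Ioo 0 (1 + ε),
      |deriv f y - deriv f x| ≤ M₂ * |y - x| :=
    fun x hx y hy => (convex_Ioo 0 (1 + ε)).norm_image_sub_le_of_norm_deriv_le hdiff1 hb₂ hx hy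
  have hTay : ∀ a ∈ Ioo 0 (1 + ε), ∀ r ∈ Ioo 0 (1 + ε),
      |f r - f a - deriv f a * (r - a)| ≤ M₂ * (r - a) ^ 2 := fun a ha r hr => by
    -- On the segment from a to r, the derivative of x ↦ f(x) - f'(a)(x - a) is at most M₂|r - a|.
    have hseg : uIcc a r ⊆ Ioo 0 (1 + ε) := ordConnected_Ioo.uIcc_subset ha hr
    have h := (convex_uIcc a r).norm_image_sub_le_of_norm_deriv_le
      (f := fun x => f x - deriv f a * (x - a)) (C := M₂ * |r - a|)
      (fun x hx => (hdiff x (hseg hx)).sub (by fun_prop))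
      (fun x hx => by
        have : deriv (fun x => f x - deriv f a * (x - a)) x = deriv f x - deriv f a := by
          rw [deriv_fun_sub (hdiff x (hseg hx)) (by fun_prop)]
          simp
        rw [this, Real.norm_eq_abs]
        exact (hLip' a ha x (hseg hx)).trans
          (mul_le_mul_of_nonneg_left (abs_sub_left_of_mem_uIcc hx) hM₂0))
      left_mem_uIcc right_mem_uIcc
    simp only [Real.norm_eq_abs, sub_self, mul_zero, sub_zero] at h
    rw [sub_right_comm, ← sq_abs, pow_two, ← mul_assoc]
    exact h
  refine ⟨hf.measurable, ⟨M, hM⟩, fun a ha => hdiff a (hsub ha), hC1.continuousOn.mono hsub,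
    ⟨M₁ + M₂ + 2 * M / ε + 2 * M / ε ^ 2 + M₁ / ε, by positivity, fun a ha => ⟨?_, fun r hr => ?_⟩⟩⟩
  · have e0 : 0 ≤ M₂ + 2 * M / ε + 2 * M / ε ^ 2 + M₁ / ε := by positivity
    linarith [hb₁ a (hsub ha)]
  · rcases lt_or_ge r (1 + ε) with hr' | hr'
    · refine ⟨(hLip a (hsub ha) r ⟨hr, hr'⟩).trans ?_, (hTay a (hsub ha) r ⟨hr, hr'⟩).trans ?_⟩
      · gcongr
        have e0 : 0 ≤ M₂ + 2 * M / ε + 2 * M / ε ^ 2 + M₁ / ε := by positivity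
        linarith
      · gcongr
        have e0 : 0 ≤ M₁ + 2 * M / ε + 2 * M / ε ^ 2 + M₁ / ε := by positivity
        linarith
    · have hra : ε ≤ r - a := by linarith [ha.2]
      have hra0 : 0 < r - a := by linarith
      have h2M : |f r - f a| ≤ 2 * M :=
        (abs_sub _ _).trans (by linarith [hM r hr.le, hM a ha.1.le])
      have q1 : 1 ≤ (r - a) / ε := (one_le_div hε).2 hra
      constructor
      · rw [abs_of_pos hra0]
        calc |f r - f a| ≤ 2 * M * 1 := by linarith
          _ ≤ 2 * M * ((r - a) / ε) := by gcongr
          _ = 2 * M / ε * (r - a) := by ring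
          _ ≤ _ := by
            gcongr
            have e0 : 0 ≤ M₁ + M₂ + 2 * M / ε ^ 2 + M₁ / ε := by positivity
            linarith
      · calc |f r - f a - deriv f a * (r - a)| ≤ 2 * M + M₁ * (r - a) := by
              refine (abs_sub _ _).trans ?_
              rw [abs_mul, abs_of_pos hra0]
              gcongr
              exact hb₁ a (hsub ha)
          _ ≤ 2 * M * ((r - a) / ε) ^ 2 + M₁ * (r - a) * ((r - a) / ε) := by
              exact add_le_add (le_mul_of_one_le_right (by positivity) (one_le_pow₀ q1))
                (le_mul_of_one_le_right (by positivity) q1)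
          _ = (2 * M / ε ^ 2 + M₁ / ε) * (r - a) ^ 2 := by
              field_simp
          _ ≤ _ := by
              gcongr
              have e0 : 0 ≤ M₁ + M₂ + 2 * M / ε := by positivity
              linarith

/-! ### Riemann sums and the limiting variance -/

/-- The sum is the integral of the step function u ↦ h(⌈uN⌉/N), and dominated convergence applies.
The ceiling selects right endpoints, so h is never sampled at 0, where nothing is assumed about it.
-/
theorem tendsto_riemannSum {h : ℝ → ℝ} (hc : ContinuousOn h (Ioc 0 1)) {C : ℝ}
    (hC : ∀ x ∈ Ioc (0 : ℝ) 1, |h x| ≤ C) :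
    Tendsto (fun N : ℕ => ∑ j : Fin N, h (((j : ℕ) + 1 : ℝ) / N) / N) atTop
      (𝓝 (∫ x in (0 : ℝ)..1, h x)) := by
  set G : ℕ → ℝ → ℝ := fun N u => h ((⌈u * N⌉₊ : ℝ) / N) with hG
  have hmem : ∀ N : ℕ, 0 < N → ∀ u ∈ Ioc (0 : ℝ) 1, ((⌈u * N⌉₊ : ℝ) / N) ∈ Ioc (0 : ℝ) 1 :=
    fun N hN u hu => by
    have hN' : (0 : ℝ) < N := by exact_mod_cast hN
    constructor
    · have : 0 < ⌈u * N⌉₊ := Nat.ceil_pos.2 (mul_pos hu.1 hN')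
      positivity
    · rw [div_le_one hN']
      have : ⌈u * N⌉₊ ≤ N := Nat.ceil_le.2 (by nlinarith [hu.2])
      exact_mod_cast this
  have hGm : ∀ N, Measurable (G N) := fun N =>
    (measurable_from_nat (f := fun k : ℕ => h ((k : ℝ) / N))).comp
      (Nat.measurable_ceil.comp (measurable_id.mul_const _))
  have hlim : Tendsto (fun N => ∫ u in (0 : ℝ)..1, G N u) atTop (𝓝 (∫ x in (0 : ℝ)..1, h x)) := by
    refine intervalIntegral.tendsto_integral_filter_of_dominated_convergence (fun _ => C)
      (Eventually.of_forall fun N => (hGm N).aestronglyMeasurable) ?_ (by simp)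
      (ae_of_all _ fun u hu => ?_)
    · filter_upwards [eventually_gt_atTop 0] with N hN
      refine ae_of_all _ fun u hu => ?_
      rw [uIoc_of_le zero_le_one] at hu
      exact hC _ (hmem N hN u hu)
    · rw [uIoc_of_le zero_le_one] at hu
      refine (hc u hu).tendsto.comp (tendsto_nhdsWithin_iff.2 ⟨?_, ?_⟩)
      · exact (tendsto_nat_ceil_mul_div_atTop hu.1.le).comp tendsto_natCast_atTop_atTop
      · filter_upwards [eventually_gt_atTop 0] with N hN
        exact hmem N hN u hu
  refine hlim.congr' ?_
  filter_upwards [eventually_gt_atTop 0] with N hN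
  have hN' : (0 : ℝ) < N := by exact_mod_cast hN
  have hconst : ∀ k : ℕ, ∀ u ∈ Ioc ((k : ℝ) / N) (((k + 1 : ℕ) : ℝ) / N),
      G N u = h (((k : ℝ) + 1) / N) := fun k u hu => by
    have : ⌈u * N⌉₊ = k + 1 := by
      rw [Nat.ceil_eq_iff (by omega)]
      refine ⟨?_, (le_div_iff₀ hN').1 hu.2⟩
      simpa using (div_lt_iff₀ hN').1 hu.1
    simp only [hG, this]
    push_cast
    rfl
  have hle : ∀ k : ℕ, (k : ℝ) / N ≤ ((k + 1 : ℕ) : ℝ) / N := fun k => by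
    gcongr
    simp
  have hint : ∀ k < N, IntervalIntegrable (G N) volume ((k : ℝ) / N) (((k + 1 : ℕ) : ℝ) / N) :=
    fun k _ => by
    refine (intervalIntegrable_const (c := h (((k : ℝ) + 1) / N))).congr fun u hu => ?_
    rw [uIoc_of_le (hle k)] at hu
    exact (hconst k u hu).symm
  have hsum := intervalIntegral.sum_integral_adjacent_intervals (a := fun k : ℕ => (k : ℝ) / N) hint
  simp only [Nat.cast_zero, zero_div, div_self hN'.ne'] at hsum
  rw [← hsum, Fin.sum_univ_eq_sum_range (fun k : ℕ => h (((k : ℝ) + 1) / N) / N)]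
  refine Finset.sum_congr rfl fun k _ => ?_
  rw [intervalIntegral.integral_of_le (hle k), setIntegral_congr_fun measurableSet_Ioc (hconst k),
    ← intervalIntegral.integral_of_le (hle k), intervalIntegral.integral_const, smul_eq_mul]
  push_cast
  ring

theorem integral_comp_sqrt_eq (h : ℝ → ℝ) :
    ∫ u in (0 : ℝ)..1, h (√u) = 2 * ∫ r in (0 : ℝ)..1, h r * r := by
  have himg : (fun r : ℝ => r ^ 2) '' Ioc 0 1 = Ioc 0 1 := by
    ext u
    constructor
    · rintro ⟨r, hr, rfl⟩
      exact ⟨pow_pos hr.1 2, pow_le_one₀ hr.1.le hr.2⟩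
    · intro hu
      exact ⟨√u, ⟨Real.sqrt_pos.2 hu.1, Real.sqrt_le_one.2 hu.2⟩, Real.sq_sqrt hu.1.le⟩
  have hinj : InjOn (fun r : ℝ => r ^ 2) (Ioc 0 1) := fun x hx y hy hxy =>
    (pow_left_inj₀ hx.1.le hy.1.le two_ne_zero).1 hxy
  have hcov := integral_image_eq_integral_abs_deriv_smul (f' := fun r : ℝ => 2 * r)
    measurableSet_Ioc (fun r _ => by simpa using (hasDerivAt_pow 2 r).hasDerivWithinAt) hinj
    (fun u => h (√u))
  rw [himg] at hcov
  rw [intervalIntegral.integral_of_le zero_le_one, hcov,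
    intervalIntegral.integral_of_le zero_le_one, ← integral_const_mul]
  refine setIntegral_congr_fun measurableSet_Ioc fun r hr => ?_
  simp only [smul_eq_mul]
  rw [Real.sqrt_sq hr.1.le, abs_of_pos (by linarith [hr.1])]
  ring

theorem IsTaylorProfile.intervalIntegrable {f g : ℝ → ℝ} (hf : IsTaylorProfile f)
    (hg : IsTaylorProfile g) :
    IntervalIntegrable (fun r => deriv f r * deriv g r * r) volume 0 1 := by
  obtain ⟨Lf, hLf, hTf⟩ := hf.taylor
  obtain ⟨Lg, hLg, hTg⟩ := hg.taylor
  rw [intervalIntegrable_iff_integrableOn_Ioc_of_le zero_le_one]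
  refine Integrable.of_bound (C := Lf * Lg * 1)
    (((hf.continuousOn_deriv.mul hg.continuousOn_deriv).mul continuousOn_id).aestronglyMeasurable
      measurableSet_Ioc) ?_
  filter_upwards [ae_restrict_mem measurableSet_Ioc] with r hr
  rw [Real.norm_eq_abs, abs_mul, abs_mul]
  have h1 := (hTf r hr).1
  have h2 := (hTg r hr).1
  gcongr
  rw [abs_of_pos hr.1]
  exact hr.2

theorem IsTaylorProfile.limitCov_add {f g : ℝ → ℝ} (hf : IsTaylorProfile f)
    (hg : IsTaylorProfile g) :
    limitCov (f + g) (f + g) = limitCov f f + 2 * limitCov f g + limitCov g g := by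
  have hff := hf.intervalIntegrable hf
  have hfg := hf.intervalIntegrable hg
  have hgg := hg.intervalIntegrable hg
  have h : ∫ r in (0 : ℝ)..1, deriv (f + g) r * deriv (f + g) r * r =
      ∫ r in (0 : ℝ)..1, (deriv f r * deriv f r * r + 2 * (deriv f r * deriv g r * r) +
        deriv g r * deriv g r * r) := by
    rw [intervalIntegral.integral_of_le zero_le_one, intervalIntegral.integral_of_le zero_le_one]
    refine setIntegral_congr_fun measurableSet_Ioc fun r hr => ?_
    rw [deriv_add (hf.differentiableAt r hr) (hg.differentiableAt r hr)]
    ring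
  unfold limitCov
  rw [h, intervalIntegral.integral_add (hff.add (hfg.const_mul 2)) hgg,
    intervalIntegral.integral_add hff (hfg.const_mul 2), intervalIntegral.integral_const_mul]
  ring

/-- A Cesàro mean of a null sequence. It disposes of the variance errors, which are not uniformly
o(1/N) in j. -/
theorem tendsto_inv_mul_sum_one_div_sqrt :
    Tendsto (fun N : ℕ => ∑ j : Fin N, 1 / (N * √((j : ℕ) + 1 : ℝ))) atTop (𝓝 0) := by
  have h0 : Tendsto (fun n : ℕ => 1 / √((n : ℝ) + 1)) atTop (𝓝 0) := by
    simp only [one_div]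
    exact (Real.tendsto_sqrt_atTop.comp (tendsto_atTop_add_const_right _ 1
      (tendsto_natCast_atTop_atTop (R := ℝ)))).inv_tendsto_atTop
  refine h0.cesaro.congr fun N => ?_
  rw [Fin.sum_univ_eq_sum_range (fun j : ℕ => 1 / (N * √((j : ℝ) + 1))), Finset.mul_sum]
  refine Finset.sum_congr rfl fun j _ => ?_
  rw [one_div, one_div, mul_inv]

theorem IsTaylorProfile.tendsto_sum_variance {f : ℝ → ℝ} (hf : IsTaylorProfile f) :
    Tendsto (fun N : ℕ => ∑ j : Fin N, Var[radial f; radialLaw N j]) atTop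
      (𝓝 (limitCov f f)) := by
  obtain ⟨K, hK⟩ := hf.radialLaw_estimates
  obtain ⟨L, hL, hT⟩ := hf.taylor
  have hsq : ∀ u ∈ Ioc (0 : ℝ) 1, √u ∈ Ioc (0 : ℝ) 1 := fun u hu =>
    ⟨Real.sqrt_pos.2 hu.1, Real.sqrt_le_one.2 hu.2⟩
  -- The main terms f'(a)²/(4N), with a² = (j + 1)/N, form a Riemann sum in u = a².
  have hR := tendsto_riemannSum (h := fun u => deriv f (√u) ^ 2 / 4) (C := L ^ 2 / 4)
    (((hf.continuousOn_deriv.comp Real.continuous_sqrt.continuousOn hsq).pow 2).div_const 4)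
    fun u hu => by
      rw [abs_of_nonneg (by positivity), ← sq_abs]
      gcongr
      exact (hT _ (hsq u hu)).1
  have hval : ∫ u in (0 : ℝ)..1, deriv f (√u) ^ 2 / 4 = limitCov f f := by
    rw [integral_comp_sqrt_eq fun r => deriv f r ^ 2 / 4]
    unfold limitCov
    rw [← intervalIntegral.integral_const_mul, ← intervalIntegral.integral_const_mul]
    congr 1
    funext r
    ring
  rw [hval] at hR
  refine (tendsto_iff_of_dist ?_).1 hR
  have hz := tendsto_inv_mul_sum_one_div_sqrt.const_mul K
  rw [mul_zero] at hz
  refine squeeze_zero (fun _ => dist_nonneg) (fun N => ?_) hz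
  rw [dist_comm, Real.dist_eq, ← Finset.sum_sub_distrib, Finset.mul_sum]
  refine (Finset.abs_sum_le_sum_abs _ _).trans (Finset.sum_le_sum fun j _ => ?_)
  rw [mul_one_div, div_div]
  exact (hK N j).2.2

/-! ### Covariance limit and central limit theorem -/

theorem IsTaylorProfile.tendsto_variance {f : ℝ → ℝ} (hf : IsTaylorProfile f) :
    Tendsto (fun N : ℕ => Var[linearStatistic N (radial f); ginibre N]) atTop
      (𝓝 (limitCov f f)) := by
  obtain ⟨M, hM⟩ := hf.bounded
  simp only [variance_linearStatistic_ginibre _ hf.measurable fun z => hM _ (norm_nonneg z)]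
  exact hf.tendsto_sum_variance

theorem IsTaylorProfile.memLp_linearStatistic {f : ℝ → ℝ} (hf : IsTaylorProfile f) (N : ℕ) :
    MemLp (linearStatistic N (radial f)) 2 (ginibre N) := by
  obtain ⟨M, hM⟩ := hf.bounded
  refine memLp_of_abs_le (measurable_linearStatistic N hf.measurable) (M := N * M) (fun z => ?_) 2
  refine (Finset.abs_sum_le_sum_abs _ _).trans ?_
  refine (Finset.sum_le_sum fun k _ => hM _ (norm_nonneg (z k))).trans_eq ?_
  simp

/-- Polarization: the variance limit is applied to f + g, f and g, so the joint law of the two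
statistics is never needed. -/
theorem IsTaylorProfile.tendsto_covariance {f g : ℝ → ℝ} (hf : IsTaylorProfile f)
    (hg : IsTaylorProfile g) :
    Tendsto (fun N : ℕ =>
      cov[linearStatistic N (radial f), linearStatistic N (radial g); ginibre N]) atTop
      (𝓝 (limitCov f g)) := by
  have h := (((hf.add hg).tendsto_variance.sub hf.tendsto_variance).sub
    hg.tendsto_variance).div_const 2
  rw [hf.limitCov_add hg] at h
  have e : (limitCov f f + 2 * limitCov f g + limitCov g g - limitCov f f - limitCov g g) / 2 =
      limitCov f g := by ring
  rw [e] at h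
  refine h.congr fun N => ?_
  have hadd : linearStatistic N (radial (f + g)) =
      linearStatistic N (radial f) + linearStatistic N (radial g) := by
    funext z
    simp [linearStatistic, radial, Finset.sum_add_distrib]
  rw [hadd, variance_add (hf.memLp_linearStatistic N) (hg.memLp_linearStatistic N)]
  ring

/-- Lyapunov's theorem is applied to the independent variables, each centered at its own mean. The
resulting phases multiply to that of E[X(f)], because the means add up to it. -/
theorem IsTaylorProfile.tendsto_integral_exp {f : ℝ → ℝ} (hf : IsTaylorProfile f) (t : ℝ) :
    Tendsto (fun N : ℕ => ∫ z, Complex.exp ((t * (linearStatistic N (radial f) z -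
      ∫ w, linearStatistic N (radial f) w ∂(ginibre N)) : ℝ) * Complex.I) ∂(ginibre N)) atTop
      (𝓝 (Complex.exp (-(t ^ 2 * limitCov f f / 2 : ℝ)))) := by
  obtain ⟨K, hK⟩ := hf.radialLaw_estimates
  obtain ⟨M, hM⟩ := hf.bounded
  have hMr : ∀ z, |radial f z| ≤ M := fun z => hM _ (norm_nonneg z)
  have hvar : ∀ N (j : Fin N),
      ∫ z, (radial f z - ∫ w, radial f w ∂(radialLaw N j)) ^ 2 ∂(radialLaw N j) =
        Var[radial f; radialLaw N j] := fun N j =>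
    (variance_eq_integral hf.measurable.aemeasurable).symm
  have hint : ∀ N (j : Fin N), Integrable (radial f) (radialLaw N j) := fun N j =>
    Integrable.of_bound hf.measurable.aestronglyMeasurable M (ae_of_all _ hMr)
  have hmean : ∀ N (j : Fin N), |∫ w, radial f w ∂(radialLaw N j)| ≤ M := fun N j => by
    have h := norm_integral_le_of_norm_le_const (μ := radialLaw N j) (f := radial f) (ae_of_all _ hMr)
    simpa using h
  have h := tendsto_prod_integral_exp radialLaw
    (fun N j z => radial f z - ∫ w, radial f w ∂(radialLaw N j))
    (fun N j => hf.measurable.sub_const _) (M := M + M)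
    (fun N j z => (abs_sub _ _).trans (add_le_add (hMr z) (hmean N j)))
    (fun N j => by rw [integral_sub (hint N j) (integrable_const _)]; simp)
    (K := K) (fun N j => (hvar N j).trans_le (hK N j).1) (fun N j => (hK N j).2.1)
    (by simpa only [hvar] using hf.tendsto_sum_variance) t
  refine h.congr fun N => ?_
  have e1 : ∀ j : Fin N, ∫ z, Complex.exp
      ((t * (radial f z - ∫ w, radial f w ∂(radialLaw N j)) : ℝ) * Complex.I) ∂(radialLaw N j) =
      (∫ z, Complex.exp ((t * radial f z : ℝ) * Complex.I) ∂(radialLaw N j)) *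
        Complex.exp (-((t * ∫ w, radial f w ∂(radialLaw N j) : ℝ) * Complex.I)) := fun j => by
    rw [← integral_mul_const]
    refine integral_congr_ae (ae_of_all _ fun z => ?_)
    simp only
    rw [← Complex.exp_add]
    congr 1
    push_cast
    ring
  simp only [e1]
  rw [Finset.prod_mul_distrib, ← integral_exp_linearStatistic_ginibre N hf.measurable t,
    ← integral_mul_const, integral_linearStatistic_ginibre N hf.measurable hMr]
  refine integral_congr_ae (ae_of_all _ fun z => ?_)
  simp only
  rw [← Complex.exp_sum, ← Complex.exp_add]
  congr 1
  push_cast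
  rw [Finset.sum_neg_distrib, ← Finset.sum_mul, ← Finset.mul_sum]
  ring

/-- Lévy's continuity theorem. A vanishing variance needs no separate treatment, since the formula
for the Gaussian characteristic function covers the point mass. -/
theorem IsTaylorProfile.tendstoInDistribution {f : ℝ → ℝ} (hf : IsTaylorProfile f) :
    TendstoInDistribution
      (fun (N : ℕ) (z : Fin N → ℂ) =>
        linearStatistic N (radial f) z - ∫ w, linearStatistic N (radial f) w ∂(ginibre N))
      atTop (id : ℝ → ℝ) (fun N : ℕ => ginibre N)
      (gaussianReal 0 (limitCov f f).toNNReal) where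
  forall_aemeasurable N := ((measurable_linearStatistic N hf.measurable).sub_const _).aemeasurable
  aemeasurable_limit := aemeasurable_id
  tendsto := by
    refine ProbabilityMeasure.tendsto_iff_tendsto_charFun.2 fun t => ?_
    have hm : ∀ N : ℕ, Measurable fun z : Fin N → ℂ =>
        linearStatistic N (radial f) z - ∫ w, linearStatistic N (radial f) w ∂(ginibre N) :=
      fun N => (measurable_linearStatistic N hf.measurable).sub_const _
    simp only [ProbabilityMeasure.coe_mk, Measure.map_id, charFun_gaussianReal,
      Real.coe_toNNReal _ (limitCov_self_nonneg f)]
    have h := hf.tendsto_integral_exp t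
    have e : Complex.exp (-(t ^ 2 * limitCov f f / 2 : ℝ)) =
        Complex.exp (t * (0 : ℝ) * Complex.I - (limitCov f f : ℂ) * (t : ℂ) ^ 2 / 2) := by
      congr 1
      push_cast
      ring
    rw [e] at h
    refine h.congr fun N => ?_
    rw [charFun_apply_real, integral_map (hm N).aemeasurable (by fun_prop)]
    refine integral_congr_ae (ae_of_all _ fun z => ?_)
    simp only [Complex.ofReal_mul]

theorem theorem3 (δ : ℝ≥0) (hδ : 0 < δ) (ε : ℝ) (hε : 0 < ε) (f g : ℝ → ℝ)
    (hf : IsRadialTest δ ε f) (hg : IsRadialTest δ ε g) :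
    (IntervalIntegrable (fun r => deriv f r * deriv g r * r) volume 0 1 ∧
      Tendsto
        (fun N : ℕ =>
          cov[linearStatistic N (radial f), linearStatistic N (radial g); ginibre N])
        atTop (𝓝 (limitCov f g))) ∧
    TendstoInDistribution
      (fun (N : ℕ) (z : Fin N → ℂ) =>
        linearStatistic N (radial f) z - ∫ w, linearStatistic N (radial f) w ∂(ginibre N))
      atTop (id : ℝ → ℝ) (fun N : ℕ => ginibre N)
      (gaussianReal 0 (limitCov f f).toNNReal) := by
  have hf' := hf.isTaylorProfile hε
  have hg' := hg.isTaylorProfile hε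
  exact ⟨⟨hf'.intervalIntegrable hg', hf'.tendsto_covariance hg'⟩, hf'.tendstoInDistribution⟩
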